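/- Let $r\ge 1$. For $\mathbf u\in\mathbb C^r$ and $\mathbf b\in\mathbb Z_{\ge0}^r$ with $b_1\ge1$ let $$\mathrm{Li}_{\mathbf u}(\mathbf z;\mathbf b)=\sum_{l_1\ge b_1,\ldots,l_r\ge b_r}\frac{z_1^{l_1}\cdots z_r^{l_r}}{l_1^{u_1}(l_1+l_2)^{u_2}\cdots(l_1+\cdots+l_r)^{u_r}}\qquad(|z_j|<1),$$ and denote by the same symbol its analytic continuation in $\mathbf z$ to $(\mathbb C\setminus[1,\infty))^r$. For a permutation $\sigma\in\mathfrak S_r$, $\mathbf a,\mathbf b\in\mathbb Z_{\ge0}^r$ and $\mathbf u,\mathbf s\in\mathbb C^r$ with $\operatorname{Re}u_j,\operatorname{Re}s_j>0$, put $T_j=t_j+t_{j+1}+\cdots+t_r$ and $$\eta(\mathbf u;\mathbf s;\sigma;\mathbf a;\mathbf b)=\prod_{j=1}^r\frac1{\Gamma(s_j)}\int_{(0,\infty)^r}\prod_{j=1}^r t_j^{s_j-1}e^{(1-a_j)T_j}\;\frac{\mathrm{Li}_{\mathbf u}(1-e^{T_{\sigma(1)}},\ldots,1-e^{T_{\sigma(r)}};\mathbf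 b)}{\prod_{j=1}^r(1-e^{T_{\sigma(j)}})^{b_j}}\,dt_1\cdots dt_r,$$ and denote by the same symbol its analytic continuation in $(\mathbf u,\mathbf s)$ to $\mathbb C^{2r}$. Theorem. Let $\sigma\in\mathfrak S_r$ and $\mathbf a,\mathbf b\in\mathbb Z_{\ge0}^r$ satisfy $a_1,a_{\sigma^{-1}(1)}\ge1$, $b_1,b_{\sigma^{-1}(1)}\ge1$ and $a_{\sigma(j)}+b_j\ge1$ for $j=1,\ldots,r$. Then the functions $\eta(\,\cdot\,;\,\cdot\,;\sigma;\mathbf a;\mathbf b)$ and $\eta(\,\cdot\,;\,\cdot\,;\sigma^{-1};\mathbf b;\mathbf a)$ are well defined (for positive real parts the series, its continuation to $(\mathbb C\setminus[1,\infty))^r$ and the absolutely convergent integral exist, and the integral continues analytically to $\mathbb C^{2r}$), and for all $\mathbf u,\mathbf s\in\mathbb C^r$ $$\eta(\mathbf u;\mathbf s;\sigma;\mathbf a;\mathbf b)=\eta(\mathbf s;\mathbf u;\sigma^{-1};\mathbf b;\mathbf a).$$ -/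

import Mathlib

noncomputable section

/-- `F` is holomorphic (complex differentiable) on the set `U` and agrees with `f` on `V`.
It is used only for `U` open and connected and `V ⊆ U` open and nonempty, where `F` is then
unique on `U`: it is the analytic continuation of `f` from `V` to `U`. -/
def IsAnalyticContinuation {E : Type*} [NormedAddCommGroup E] [NormedSpace ℂ E]
    (f : E → ℂ) (V U : Set E) (F : E → ℂ) : Prop :=
  DifferentiableOn ℂ F U ∧ Set.EqOn F f V

open Classical in
/-- The analytic continuation of `f` from `V` to `U` (`0` if there is none). -/
def analyticContinuation {E : Type*} [NormedAddCommGroup E] [NormedSpace ℂ E]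
    (f : E → ℂ) (V U : Set E) : E → ℂ :=
  if h : ∃ F, IsAnalyticContinuation f V U F then h.choose else 0

variable {r : ℕ}

/-- The general term of the polylogarithm series, with the summation variables written as
`l_j = n_j + b_j` with `n_j ≥ 0`:
`z₁^{l₁} ⋯ z_r^{l_r} / (l₁^{u₁} (l₁+l₂)^{u₂} ⋯ (l₁+⋯+l_r)^{u_r})`. -/
def polylogTerm (u z : Fin r → ℂ) (b n : Fin r → ℕ) : ℂ :=
  (∏ j, z j ^ (n j + b j)) /
    ∏ j, ((∑ i ∈ Finset.Iic j, (n i + b i) : ℕ) : ℂ) ^ u j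

/-- The series defining the multiple polylogarithm of shuffle type for `|z_j| < 1`. -/
def polylogSeries (u : Fin r → ℂ) (b : Fin r → ℕ) (z : Fin r → ℂ) : ℂ :=
  ∑' n : Fin r → ℕ, polylogTerm u z b n

/-- The open unit polydisc. -/
def unitPolydisc (r : ℕ) : Set (Fin r → ℂ) := {z | ∀ j, ‖z j‖ < 1}

/-- The product of `r` copies of `ℂ ∖ [1, ∞)`. -/
def cutDomain (r : ℕ) : Set (Fin r → ℂ) :=
  {z | ∀ j, ∀ x : ℝ, 1 ≤ x → z j ≠ (x : ℂ)}

/-- The multiple polylogarithm of shuffle type `Li_u(z; b)` on `(ℂ ∖ [1, ∞))^r`: the analytic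
continuation, in `z`, of its series. -/
def polylog (u : Fin r → ℂ) (b : Fin r → ℕ) : (Fin r → ℂ) → ℂ :=
  analyticContinuation (polylogSeries u b) (unitPolydisc r) (cutDomain r)

/-- `t_j + t_{j+1} + ⋯ + t_r`. -/
def tailSum (t : Fin r → ℝ) (j : Fin r) : ℝ := ∑ i ∈ Finset.Ici j, t i

/-- The point `(1 - exp(t_{σ(1)} + t_{σ(1)+1} + ⋯ + t_r), …, 1 - exp(t_{σ(r)} + ⋯ + t_r))`. -/
def etaPoint (σ : Equiv.Perm (Fin r)) (t : Fin r → ℝ) : Fin r → ℂ :=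
  fun j => 1 - Complex.exp (tailSum t (σ j) : ℂ)

/-- The integrand of the function `η(u; s; σ; a; b)`. -/
def etaIntegrand (u s : Fin r → ℂ) (σ : Equiv.Perm (Fin r)) (a b : Fin r → ℕ)
    (t : Fin r → ℝ) : ℂ :=
  (∏ j, (t j : ℂ) ^ (s j - 1) * Complex.exp ((1 - (a j : ℂ)) * (tailSum t j : ℂ))) *
    (polylog u b (etaPoint σ t) / ∏ j, etaPoint σ t j ^ b j)

/-- The region of integration `(0, ∞)^r`. -/
def positiveOrthant (r : ℕ) : Set (Fin r → ℝ) := {t | ∀ j, 0 < t j}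

/-- The integral defining `η(u; s; σ; a; b)` at `p = (u, s)` when all `Re u_j`, `Re s_j` are
positive. -/
def etaIntegral (σ : Equiv.Perm (Fin r)) (a b : Fin r → ℕ)
    (p : (Fin r → ℂ) × (Fin r → ℂ)) : ℂ :=
  (∏ j, 1 / Complex.Gamma (p.2 j)) *
    ∫ t in positiveOrthant r, etaIntegrand p.1 p.2 σ a b t

/-- The set of `(u, s) ∈ ℂ^r × ℂ^r` with `Re u_j > 0` and `Re s_j > 0` for all `j`. -/
def positiveRegion (r : ℕ) : Set ((Fin r → ℂ) × (Fin r → ℂ)) :=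
  {p | (∀ j, 0 < (p.1 j).re) ∧ ∀ j, 0 < (p.2 j).re}

/-- The Arakawa–Kaneko type function `η(u; s; σ; a; b)` for `(u, s) ∈ ℂ^{2r}`: the analytic
continuation of the integral from `positiveRegion r` to `ℂ^{2r}`. -/
def eta (u s : Fin r → ℂ) (σ : Equiv.Perm (Fin r)) (a b : Fin r → ℕ) : ℂ :=
  analyticContinuation (etaIntegral σ a b) (positiveRegion r) Set.univ (u, s)

/-- Every operation in the definition of `η(·; ·; σ; a; b)` makes sense: the polylogarithm
series converges and has an analytic continuation, the integral converges absolutely, and the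
resulting function has an analytic continuation to `ℂ^{2r}`. -/
structure EtaWellDefined (σ : Equiv.Perm (Fin r)) (a b : Fin r → ℕ) : Prop where
  summable : ∀ u : Fin r → ℂ, (∀ j, 0 < (u j).re) → ∀ z ∈ unitPolydisc r,
    Summable (polylogTerm u z b)
  polylog_continuation : ∀ u : Fin r → ℂ, (∀ j, 0 < (u j).re) →
    ∃ L, IsAnalyticContinuation (polylogSeries u b) (unitPolydisc r) (cutDomain r) L
  integrable : ∀ p ∈ positiveRegion r,
    MeasureTheory.IntegrableOn (etaIntegrand p.1 p.2 σ a b) (positiveOrthant r)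
  eta_continuation :
    ∃ F, IsAnalyticContinuation (etaIntegral σ a b) (positiveRegion r) Set.univ F

end

/-! Write X_j and T_j for the tail sums of x and t. For Re u > 0, Γ(u) N^(-u) is the integral of
x^(u-1) e^(-Nx) over (0,∞). Hence the polylogarithm is, up to Gamma factors, the Mellin transform in
x of the sum over l of ∏ (z_j e^(-X_j))^(l_j). This is a product of geometric series with value ∏
z_j^(b_j) e^((1-b_j)X_j) / (e^(X_j) - z_j). The Mellin integral of that value converges and is
holomorphic for z in the whole cut domain, so it is the continuation (`polylog_eq_gammaMellin`).

At z_j = 1 - e^(T_σ(j)) the denominators become e^(X_j) + e^(T_σ(j)) - 1, and z_j^(b_j) cancels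
against the denominator in η. So η is the normalized 2r-fold Mellin transform of `etaKernel`, which
is invariant under exchanging (x, b, σ) with (t, a, σ⁻¹). Fubini gives the duality for positive real
parts. The conditions on a and b make the kernel O(exp(-(∑ x_i + ∑ t_i)/2)) (`norm_etaKernel_le`),
which justifies Fubini.

For the continuation, each partial derivative of the kernel is the kernel times a polynomial in
bounded quotients, so all derivatives decay equally fast (`isDerivClosed_expQuotFamily`).
Integration by parts raises the exponents by 1, and iterating it yields an entire function
(`IsDerivClosed.exists_entire_gammaMellin`). The same entire function continues both integrals, and
the identity theorem identifies it with both values of `eta`. -/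

open MeasureTheory Filter Topology Metric Set

/-! ### Holomorphic parameter integrals and the identity theorem. -/

/-- Holomorphy of a parameter integral over a finite-dimensional complex parameter space, from a
locally uniform integrable bound on the integrand. -/
theorem differentiableAt_integral_of_norm_le {α ι : Type*} [MeasurableSpace α] {μ : Measure α}
    [Fintype ι] {F : (ι → ℂ) → α → ℂ} {w₀ : ι → ℂ} {R : ℝ} (hR : 0 < R) {bound : α → ℝ}
    (hmeas : ∀ w ∈ ball w₀ R, AEStronglyMeasurable (F w) μ)
    (hdiff : ∀ᵐ a ∂μ, DifferentiableOn ℂ (fun w => F w a) (ball w₀ R))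
    (hbound : ∀ᵐ a ∂μ, ∀ w ∈ ball w₀ R, ‖F w a‖ ≤ bound a) (hint : Integrable bound μ) :
    DifferentiableAt ℂ (fun w => ∫ a, F w a ∂μ) w₀ := by
  classical
  have hmem : w₀ ∈ ball w₀ R := mem_ball_self hR
  have hd : ∀ᵐ a ∂μ, HasFDerivAt (fun w => F w a) (fderiv ℂ (fun w => F w a) w₀) w₀ := by
    filter_upwards [hdiff] with a ha
    exact (ha.differentiableAt (ball_mem_nhds _ hR)).hasFDerivAt
  -- The partial derivatives are measurable in `a` as limits of difference quotients along the null
  -- sequence `c n`; `c n < R` keeps the points in the ball.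
  have hcoord (i : ι) : AEStronglyMeasurable
      (fun a => fderiv ℂ (fun w => F w a) w₀ (Pi.single i 1)) μ := by
    set c : ℕ → ℝ := fun n => R / 2 * (1 / ((n : ℝ) + 1)) with hc
    have hc0 (n : ℕ) : 0 < c n := by positivity
    have hcR (n : ℕ) : c n < R := by
      have : 1 / ((n : ℝ) + 1) ≤ 1 := by
        rw [div_le_one (by positivity)]
        linarith [Nat.cast_nonneg (α := ℝ) n]
      have := mul_le_mul_of_nonneg_left this (half_pos hR).le
      simp only [hc]
      linarith
    have hclim : Tendsto c atTop (𝓝 0) := by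
      simpa [hc] using (tendsto_one_div_add_atTop_nhds_zero_nat (𝕜 := ℝ)).const_mul (R / 2)
    have hin (n : ℕ) : w₀ + (c n : ℂ) • Pi.single i (1 : ℂ) ∈ ball w₀ R := by
      rw [mem_ball_iff_norm, add_sub_cancel_left, norm_smul, Pi.norm_single]
      simpa [abs_of_pos (hc0 n)] using hcR n
    refine aestronglyMeasurable_of_tendsto_ae (u := atTop)
      (f := fun n a => (c n : ℂ)⁻¹ * (F (w₀ + (c n : ℂ) • Pi.single i (1 : ℂ)) a - F w₀ a))
      (fun n => ?_) ?_
    · have := ((hmeas _ (hin n)).sub (hmeas _ hmem)).const_mul (c n : ℂ)⁻¹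
      simpa only [Pi.sub_apply] using this
    filter_upwards [hd] with a ha
    have hl : HasLineDerivAt ℂ (fun w => F w a) (fderiv ℂ (fun w => F w a) w₀ (Pi.single i 1))
      w₀ (Pi.single i 1) := ha.hasLineDerivAt _
    have := hl.tendsto_slope_zero
    refine this.comp (tendsto_nhdsWithin_iff.2 ⟨?_, ?_⟩)
    · have := (Complex.continuous_ofReal.tendsto 0).comp hclim
      rwa [Complex.ofReal_zero] at this
    · exact Eventually.of_forall fun n => by simpa using (hc0 n).ne'
  have hF' : AEStronglyMeasurable (fun a => fderiv ℂ (fun w => F w a) w₀) μ := by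
    have : (fun a => fderiv ℂ (fun w => F w a) w₀) = fun a => ∑ i,
        (fderiv ℂ (fun w => F w a) w₀ (Pi.single i 1)) •
          (ContinuousLinearMap.proj i : (ι → ℂ) →L[ℂ] ℂ) := by
      ext a v
      conv_lhs => rw [pi_eq_sum_univ' v]
      simp [mul_comm]
    rw [this]
    refine Finset.aestronglyMeasurable_fun_sum _ fun i _ => ?_
    exact (hcoord i).smul_const _
  refine (hasFDerivAt_integral_of_dominated_loc_of_lip' (ball_mem_nhds w₀ hR) hmeas
    (hint.mono' (hmeas _ hmem) (hbound.mono fun a ha => ha _ hmem)) hF'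
    (bound := fun a => 2 * bound a / R) ?_ ((hint.const_mul 2).div_const R) hd).2.differentiableAt
  filter_upwards [hdiff, hbound] with a ha hb w hw
  rw [← dist_eq_norm, ← dist_eq_norm]
  -- Schwarz lemma: `F · a` maps the ball of radius R into the closed ball of radius 2 * `bound a`
  -- about `F w₀ a`.
  refine Complex.dist_le_div_mul_dist_of_mapsTo_ball ha (fun v hv => ?_) hw
  rw [mem_closedBall, dist_eq_norm]
  calc _ ≤ ‖F v a‖ + ‖F w₀ a‖ := norm_sub_le _ _
    _ ≤ _ := by linarith [hb v hv, hb _ hmem]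

/-- Identity theorem on an open set that is star-shaped about an interior point of the set where
the two functions agree. -/
theorem eqOn_of_starConvex {E : Type*} [NormedAddCommGroup E] [NormedSpace ℂ E] {F G : E → ℂ}
    {U V : Set E} {c : E} (hU : IsOpen U) (hc : StarConvex ℝ c U) (hV : V ∈ 𝓝 c)
    (hcU : c ∈ U) (hF : DifferentiableOn ℂ F U) (hG : DifferentiableOn ℂ G U)
    (hFG : EqOn F G V) : EqOn F G U := by
  intro z hz
  -- Restricting to the complex line through `c` and `z` reduces to the one-variable identity
  -- theorem; the preimage of `U` is star-shaped about 0, hence connected.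
  set ℓ : ℂ → E := fun s => c + s • (z - c) with hℓ
  have hℓd : Differentiable ℂ ℓ := by fun_prop
  have hopen : IsOpen (ℓ ⁻¹' U) := hU.preimage hℓd.continuous
  have h0 : ℓ 0 = c := by simp [hℓ]
  have h1 : ℓ 1 = z := by simp [hℓ]
  have hstar : StarConvex ℝ 0 (ℓ ⁻¹' U) := by
    intro s hs p q hp hq hpq
    have := hc hs hp hq hpq
    have e : ℓ (p • (0 : ℂ) + q • s) = p • c + q • ℓ s := by
      have hp' : p = 1 - q := by linarith
      have : (q • s : ℂ) • (z - c) = q • (s • (z - c)) := smul_assoc _ _ _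
      simp only [hℓ, smul_zero, zero_add, this, hp', sub_smul, one_smul, smul_add]
      abel
    simpa only [mem_preimage, e] using this
  have hconn : IsPreconnected (ℓ ⁻¹' U) :=
    (hstar.isPathConnected (show (0 : ℂ) ∈ ℓ ⁻¹' U by simpa [h0] using hcU)).isConnected.isPreconnected
  have hA {H : E → ℂ} (hH : DifferentiableOn ℂ H U) : AnalyticOnNhd ℂ (H ∘ ℓ) (ℓ ⁻¹' U) :=
    (hH.comp hℓd.differentiableOn (mapsTo_preimage _ _)).analyticOnNhd hopen
  have hev : F ∘ ℓ =ᶠ[𝓝 0] G ∘ ℓ := by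
    have : ℓ ⁻¹' V ∈ 𝓝 (0 : ℂ) := hℓd.continuous.continuousAt.preimage_mem_nhds (by rwa [h0])
    filter_upwards [this] with s hs using hFG hs
  have := (hA hF).eqOn_of_preconnected_of_eventuallyEq (hA hG) hconn
    (show (0 : ℂ) ∈ ℓ ⁻¹' U by simpa [h0] using hcU) hev (show (1 : ℂ) ∈ ℓ ⁻¹' U by simpa [h1] using hz)
  simpa [h1] using this

/-- The analytic continuation is any function that continues, by the identity theorem. -/
theorem eqOn_analyticContinuation {E : Type*} [NormedAddCommGroup E] [NormedSpace ℂ E]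
    {f F : E → ℂ} {U V : Set E} {c : E} (hU : IsOpen U) (hc : StarConvex ℝ c U) (hV : V ∈ 𝓝 c)
    (hcU : c ∈ U) (hF : IsAnalyticContinuation f V U F) :
    EqOn (analyticContinuation f V U) F U := by
  have h : ∃ F, IsAnalyticContinuation f V U F := ⟨F, hF⟩
  have hs := h.choose_spec
  rw [analyticContinuation, dif_pos h]
  exact eqOn_of_starConvex hU hc hV hcU hs.1 hF.1 (hs.2.trans hF.2.symm)

theorem differentiableAt_prod {E κ : Type*} [NormedAddCommGroup E] [NormedSpace ℂ E]
    {f : κ → E → ℂ} {x : E} (s : Finset κ) (hf : ∀ i ∈ s, DifferentiableAt ℂ (f i) x) :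
    DifferentiableAt ℂ (fun x => ∏ i ∈ s, f i x) x := by
  classical
  exact (HasFDerivAt.finsetProd fun i hi => (hf i hi).hasFDerivAt).differentiableAt

/-! ### Mellin transforms in several variables: convergence and holomorphy. -/

/-- Lebesgue measure on the positive orthant. -/
noncomputable def orthantMeasure (ι : Type*) [Fintype ι] : Measure (ι → ℝ) :=
  Measure.pi fun _ => volume.restrict (Ioi 0)

instance (ι : Type*) [Fintype ι] : SigmaFinite (orthantMeasure ι) := by
  unfold orthantMeasure; infer_instance

/-- The integrand of the Mellin transform of `f` in several variables. -/
noncomputable def mellinIntegrand {ι : Type*} [Fintype ι] (f : (ι → ℝ) → ℂ) (w : ι → ℂ)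
    (y : ι → ℝ) : ℂ := (∏ i, (y i : ℂ) ^ (w i - 1)) * f y

/-- The Mellin transform of `f` in several variables, divided by the Gamma factors. -/
noncomputable def gammaMellin {ι : Type*} [Fintype ι] (f : (ι → ℝ) → ℂ) (w : ι → ℂ) : ℂ :=
  (∏ i, 1 / Complex.Gamma (w i)) * ∫ y, mellinIntegrand f w y ∂orthantMeasure ι

/-- `f` is measurable and `O(exp(-ε ∑ y_i))` on the positive orthant. -/
structure IsExpDecaying {ι : Type*} [Fintype ι] (ε : ℝ) (f : (ι → ℝ) → ℂ) : Prop where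
  measurable : Measurable f
  bound : ∃ C, 0 ≤ C ∧ ∀ y, (∀ i, 0 < y i) → ‖f y‖ ≤ C * Real.exp (-ε * ∑ i, y i)

section
variable {ι : Type*} [Fintype ι]

theorem orthantMeasure_eq_restrict :
    orthantMeasure ι = volume.restrict {y : ι → ℝ | ∀ i, 0 < y i} := by
  have : {y : ι → ℝ | ∀ i, 0 < y i} = univ.pi fun _ => Ioi 0 := by ext; simp
  rw [orthantMeasure, ← Measure.restrict_pi_pi, this]
  rfl

theorem ae_orthantMeasure_pos : ∀ᵐ y ∂orthantMeasure ι, ∀ i, 0 < y i := by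
  rw [orthantMeasure_eq_restrict]
  have : {y : ι → ℝ | ∀ i, 0 < y i} = univ.pi fun _ => Ioi 0 := by ext; simp
  have hm : MeasurableSet {y : ι → ℝ | ∀ i, 0 < y i} := by
    rw [this]
    exact MeasurableSet.univ_pi fun i => measurableSet_Ioi
  exact ae_restrict_mem hm

theorem measurable_mellinIntegrand {f : (ι → ℝ) → ℂ} (hf : Measurable f) (w : ι → ℂ) :
    Measurable (mellinIntegrand f w) := by
  unfold mellinIntegrand
  fun_prop

/-- Below t = 1 the smaller exponent dominates, above it the larger one. The sum of both gives a
bound uniform over a strip of exponents. -/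
theorem rpow_le_rpow_add_rpow {t x δ ρ : ℝ} (ht : 0 < t) (h1 : δ ≤ x) (h2 : x ≤ ρ) :
    t ^ x ≤ t ^ δ + t ^ ρ := by
  rcases le_total t 1 with h | h
  · have := Real.rpow_le_rpow_of_exponent_ge ht h h1
    have := Real.rpow_nonneg ht.le ρ
    linarith
  · have := Real.rpow_le_rpow_of_exponent_le h h2
    have := Real.rpow_nonneg ht.le δ
    linarith

theorem integrable_rpow_sub_one_mul_exp {δ ε : ℝ} (hδ : 0 < δ) (hε : 0 < ε) :
    IntegrableOn (fun t : ℝ => t ^ (δ - 1) * Real.exp (-ε * t)) (Ioi 0) := by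
  simpa using integrableOn_rpow_mul_exp_neg_mul_rpow (p := 1) (s := δ - 1) (b := ε)
    (by linarith) one_pos hε

/-- A dominating function for Mellin integrands, uniform in the exponents. -/
noncomputable def mellinBound (ι : Type*) [Fintype ι] (δ ρ ε : ℝ) (y : ι → ℝ) : ℝ :=
  ∏ i, ((y i ^ (δ - 1) + y i ^ (ρ - 1)) * Real.exp (-ε * y i))

theorem integrable_mellinBound {δ ρ ε : ℝ} (hδ : 0 < δ) (hρ : 0 < ρ) (hε : 0 < ε) :
    Integrable (mellinBound ι δ ρ ε) (orthantMeasure ι) := by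
  refine Integrable.fintype_prod
    (f := fun (_ : ι) (t : ℝ) => (t ^ (δ - 1) + t ^ (ρ - 1)) * Real.exp (-ε * t)) fun _ => ?_
  simp only [add_mul]
  exact (integrable_rpow_sub_one_mul_exp hδ hε).add (integrable_rpow_sub_one_mul_exp hρ hε)

theorem norm_mellinIntegrand_le {f : (ι → ℝ) → ℂ} {C ε δ ρ : ℝ}
    (hf : ∀ y, (∀ i, 0 < y i) → ‖f y‖ ≤ C * Real.exp (-ε * ∑ i, y i)) {w : ι → ℂ}
    (h1 : ∀ i, δ ≤ (w i).re) (h2 : ∀ i, (w i).re ≤ ρ) {y : ι → ℝ} (hy : ∀ i, 0 < y i) :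
    ‖mellinIntegrand f w y‖ ≤ C * mellinBound ι δ ρ ε y := by
  have hp : ∏ i, ‖(y i : ℂ) ^ (w i - 1)‖ ≤ ∏ i, (y i ^ (δ - 1) + y i ^ (ρ - 1)) := by
    refine Finset.prod_le_prod (fun _ _ => norm_nonneg _) fun i _ => ?_
    rw [Complex.norm_cpow_eq_rpow_re_of_pos (hy i)]
    exact rpow_le_rpow_add_rpow (hy i) (by simpa using h1 i) (by simpa using h2 i)
  rw [mellinIntegrand, norm_mul, norm_prod, mellinBound, Finset.prod_mul_distrib,
    ← Real.exp_sum, ← Finset.mul_sum]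
  calc _ ≤ (∏ i, (y i ^ (δ - 1) + y i ^ (ρ - 1))) * (C * Real.exp (-ε * ∑ i, y i)) :=
        mul_le_mul hp (hf y hy) (norm_nonneg _) (Finset.prod_nonneg fun i _ =>
          add_nonneg (Real.rpow_nonneg (hy i).le _) (Real.rpow_nonneg (hy i).le _))
    _ = _ := by ring

theorem exists_pos_lt_re {w : ι → ℂ} (hw : ∀ i, 0 < (w i).re) : ∃ δ > 0, ∀ i, δ < (w i).re := by
  have h : ∀ᶠ δ in 𝓝[>] (0 : ℝ), ∀ i, δ < (w i).re :=
    eventually_all.2 fun i => Filter.mem_of_superset (Ioo_mem_nhdsGT (hw i)) fun _ h => h.2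
  obtain ⟨δ, h1, h2⟩ := (h.and self_mem_nhdsWithin).exists
  exact ⟨δ, h2, h1⟩

theorem re_le_norm_pi (w : ι → ℂ) (i : ι) : |(w i).re| ≤ ‖w‖ :=
  (Complex.abs_re_le_norm _).trans (norm_le_pi_norm w i)

theorem IsExpDecaying.integrable_mellinIntegrand {f : (ι → ℝ) → ℂ} {ε : ℝ} (hε : 0 < ε)
    (hf : IsExpDecaying ε f) {w : ι → ℂ} (hw : ∀ i, 0 < (w i).re) :
    Integrable (mellinIntegrand f w) (orthantMeasure ι) := by
  obtain ⟨C, hC, hb⟩ := hf.bound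
  obtain ⟨δ, hδ, hδw⟩ := exists_pos_lt_re hw
  refine ((integrable_mellinBound (ρ := ‖w‖ + 1) hδ (by positivity) hε).const_mul C).mono'
    (measurable_mellinIntegrand hf.measurable w).aestronglyMeasurable ?_
  filter_upwards [ae_orthantMeasure_pos] with y hy
  exact norm_mellinIntegrand_le hb (fun i => (hδw i).le)
    (fun i => by linarith [le_abs_self (w i).re, re_le_norm_pi w i]) hy

/-- On the ball of radius δ/2 about `w` all real parts stay between δ/2 and ‖w‖ + δ, so a single
`mellinBound` dominates the integrands. -/
theorem IsExpDecaying.differentiableAt_gammaMellin {f : (ι → ℝ) → ℂ} {ε : ℝ} (hε : 0 < ε)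
    (hf : IsExpDecaying ε f) {w : ι → ℂ} (hw : ∀ i, 0 < (w i).re) :
    DifferentiableAt ℂ (gammaMellin f) w := by
  obtain ⟨C, hC, hb⟩ := hf.bound
  obtain ⟨δ, hδ, hδw⟩ := exists_pos_lt_re hw
  have hδ2 : 0 < δ / 2 := half_pos hδ
  unfold gammaMellin
  refine DifferentiableAt.mul ?_ ?_
  · have : Differentiable ℂ fun s : ℂ => 1 / Complex.Gamma s := by
      simpa using Complex.differentiable_one_div_Gamma
    refine differentiableAt_prod _ fun i _ => ?_
    exact DifferentiableAt.comp (g := fun s : ℂ => 1 / Complex.Gamma s)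
      (f := fun v : ι → ℂ => v i) w (this _) (by fun_prop)
  · have hball {v : ι → ℂ} (hv : v ∈ ball w (δ / 2)) (i : ι) :
        |(v i).re - (w i).re| < δ / 2 := by
      rw [mem_ball_iff_norm] at hv
      exact (re_le_norm_pi (v - w) i).trans_lt hv
    refine differentiableAt_integral_of_norm_le hδ2
      (bound := fun y => C * mellinBound ι (δ / 2) (‖w‖ + δ) ε y)
      (fun v _ => (measurable_mellinIntegrand hf.measurable v).aestronglyMeasurable) ?_ ?_
      ((integrable_mellinBound hδ2 (by positivity) hε).const_mul C)
    · filter_upwards [ae_orthantMeasure_pos] with y hy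
      unfold mellinIntegrand
      refine DifferentiableOn.mul ?_ (differentiableOn_const _)
      refine Differentiable.differentiableOn fun v => differentiableAt_prod _ fun i _ => ?_
      refine DifferentiableAt.const_cpow (by fun_prop) (Or.inl ?_)
      exact_mod_cast (hy i).ne'
    · filter_upwards [ae_orthantMeasure_pos] with y hy v hv
      refine norm_mellinIntegrand_le hb (fun i => ?_) (fun i => ?_) hy
      · have := abs_lt.1 (hball hv i)
        linarith [hδw i]
      · have := abs_lt.1 (hball hv i)
        linarith [le_abs_self (w i).re, re_le_norm_pi w i]

/-! ### Integration by parts and entire continuation of Mellin transforms. -/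

/-- Integration by parts for a Mellin transform in one variable. -/
theorem integral_mul_cpow_sub_one_mul {w : ℂ} (hw : 0 < w.re) {φ ψ : ℝ → ℂ} {C ε : ℝ}
    (hε : 0 < ε) (hφm : Measurable φ) (hψm : Measurable ψ)
    (hφ : ∀ x, 0 < x → ‖φ x‖ ≤ C * Real.exp (-ε * x))
    (hψ : ∀ x, 0 < x → ‖ψ x‖ ≤ C * Real.exp (-ε * x))
    (hd : ∀ x, 0 < x → HasDerivAt φ (-ψ x) x) :
    ∫ x in Ioi (0 : ℝ), (w * (x : ℂ) ^ (w - 1)) * φ x = ∫ x in Ioi (0 : ℝ), (x : ℂ) ^ w * ψ x := by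
  have hw0 : w ≠ 0 := by rintro rfl; simp at hw
  have hint {v : ℂ} (hv : 0 < v.re) {g : ℝ → ℂ} (hgm : Measurable g)
      (hg : ∀ x, 0 < x → ‖g x‖ ≤ C * Real.exp (-ε * x)) :
      IntegrableOn (fun x : ℝ => (x : ℂ) ^ (v - 1) * g x) (Ioi 0) := by
    refine ((integrable_rpow_sub_one_mul_exp hv hε).const_mul C).mono'
      (by fun_prop) ?_
    filter_upwards [ae_restrict_mem measurableSet_Ioi] with x (hx : 0 < x)
    rw [norm_mul, Complex.norm_cpow_eq_rpow_re_of_pos hx]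
    calc _ ≤ x ^ (v - 1).re * (C * Real.exp (-ε * x)) :=
          mul_le_mul_of_nonneg_left (hg x hx) (Real.rpow_nonneg hx.le _)
      _ = _ := by simp; ring
  have hlim (x : ℝ) (hx : 0 < x) :
      ‖(x : ℂ) ^ w * φ x‖ ≤ C * (x ^ w.re * Real.exp (-ε * x)) := by
    rw [norm_mul, Complex.norm_cpow_eq_rpow_re_of_pos hx]
    calc _ ≤ x ^ w.re * (C * Real.exp (-ε * x)) :=
          mul_le_mul_of_nonneg_left (hφ x hx) (Real.rpow_nonneg hx.le _)
      _ = _ := by ring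
  have key := integral_Ioi_mul_deriv_eq_deriv_mul (a := (0 : ℝ)) (a' := (0 : ℂ)) (b' := 0)
    (u := fun x : ℝ => (x : ℂ) ^ w) (v := φ) (u' := fun x : ℝ => w * (x : ℂ) ^ (w - 1))
    (v' := fun x => -ψ x)
    (fun x hx => hasDerivAt_ofReal_cpow_const (ne_of_gt hx) hw0) (fun x hx => hd x hx)
    ?_ ?_ ?_ ?_
  · simp only [mul_neg, integral_neg] at key
    rw [neg_eq_iff_eq_neg] at key
    rw [key]; simp
  · have := (hint (v := w + 1) (by simp; linarith) hψm hψ).neg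
    refine this.congr (Eventually.of_forall fun x => ?_)
    simp
  · refine ((hint hw hφm hφ).const_mul w).congr (Eventually.of_forall fun x => ?_)
    simp [mul_assoc]
  -- The boundary term at 0 vanishes because Re w > 0; the one at infinity vanishes by exponential
  -- decay.
  · have h0 : Tendsto (fun x : ℝ => C * (x ^ w.re * Real.exp (-ε * x))) (𝓝[>] 0) (𝓝 0) := by
      have : ContinuousAt (fun x : ℝ => C * (x ^ w.re * Real.exp (-ε * x))) 0 := by
        have := Real.continuousAt_rpow_const 0 w.re (Or.inr hw.le)
        fun_prop
      have h := this.tendsto.mono_left (nhdsWithin_le_nhds (s := Ioi (0 : ℝ)))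
      simpa [Real.zero_rpow hw.ne'] using h
    refine squeeze_zero_norm' ?_ h0
    filter_upwards [self_mem_nhdsWithin] with x hx using hlim x hx
  · have h0 := (tendsto_rpow_mul_exp_neg_mul_atTop_nhds_zero w.re ε hε).const_mul C
    rw [mul_zero] at h0
    refine squeeze_zero_norm' ?_ h0
    filter_upwards [eventually_gt_atTop 0] with x hx using hlim x hx

end

section
variable {ι : Type*} [Fintype ι]

/-- Two integrals over the orthant agree if the integrals along each line parallel to a fixed
coordinate axis agree. -/
theorem integral_orthant_congr_of_update [DecidableEq ι] (i : ι) {g h : (ι → ℝ) → ℂ}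
    (hg : Integrable g (orthantMeasure ι)) (hh : Integrable h (orthantMeasure ι))
    (heq : ∀ y, (∀ j, 0 < y j) →
      ∫ x in Ioi (0 : ℝ), g (Function.update y i x) = ∫ x in Ioi (0 : ℝ), h (Function.update y i x)) :
    ∫ y, g y ∂orthantMeasure ι = ∫ y, h y ∂orthantMeasure ι := by
  let ν : ι → Measure ℝ := fun _ => volume.restrict (Ioi 0)
  let e := MeasurableEquiv.piEquivPiSubtypeProd (fun _ : ι => ℝ) (fun j => j = i)
  have he : MeasurePreserving e (orthantMeasure ι)
      ((orthantMeasure {j // j = i}).prod (orthantMeasure {j // ¬ j = i})) := by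
    convert! measurePreserving_piEquivPiSubtypeProd ν (fun j => j = i)
    unfold orthantMeasure
    congr!
  have hu : MeasurePreserving (MeasurableEquiv.piUnique fun _ : {j // j = i} => ℝ)
      (orthantMeasure {j // j = i}) (volume.restrict (Ioi 0)) :=
    measurePreserving_piUnique fun _ : {j // j = i} => volume.restrict (Ioi 0)
  have hsplit {k : (ι → ℝ) → ℂ} (hk : Integrable k (orthantMeasure ι)) :
      ∫ y, k y ∂orthantMeasure ι = ∫ z, (∫ x in Ioi (0 : ℝ),
        k (e.symm (fun _ => x, z))) ∂orthantMeasure {j // ¬ j = i} := by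
    have hk' := (he.symm e).integrable_comp_emb e.symm.measurableEmbedding |>.2 hk
    rw [← (he.symm e).integral_comp' k]
    rw [integral_prod_symm (fun p => k (e.symm p)) hk']
    refine integral_congr_ae (Eventually.of_forall fun z => ?_)
    exact (hu.symm _).integral_comp' (fun x => k (e.symm (x, z))) |>.symm
  rw [hsplit hg, hsplit hh]
  refine integral_congr_ae ?_
  filter_upwards [ae_orthantMeasure_pos] with z hz
  -- The value 1 at coordinate `i` is overwritten by the update; it is chosen positive so that `heq`
  -- applies to the base point.
  have hupd (x : ℝ) : e.symm (fun _ => x, z) =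
      Function.update (fun j => if h : j = i then 1 else z ⟨j, h⟩) i x := by
    ext j
    by_cases h : j = i
    · subst h; simp [e, MeasurableEquiv.piEquivPiSubtypeProd, Equiv.piEquivPiSubtypeProd]
    · simp [e, MeasurableEquiv.piEquivPiSubtypeProd, Equiv.piEquivPiSubtypeProd, h]
  simp only [hupd]
  refine heq _ fun j => ?_
  by_cases h : j = i
  · simp [h]
  · simpa [h] using hz ⟨j, h⟩

/-- Integration by parts for a Mellin transform in several variables. -/
theorem gammaMellin_eq_of_hasDerivAt [DecidableEq ι] {ε : ℝ} (hε : 0 < ε) {f g : (ι → ℝ) → ℂ}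
    (hf : IsExpDecaying ε f) (hg : IsExpDecaying ε g) (i : ι)
    (hd : ∀ y, (∀ j, 0 < y j) → HasDerivAt (fun x => f (Function.update y i x)) (-g y) (y i))
    {w : ι → ℂ} (hw : ∀ j, 0 < (w j).re) :
    gammaMellin f w = gammaMellin g (Function.update w i (w i + 1)) := by
  set v := Function.update w i (w i + 1) with hv
  have hv_re : ∀ j, 0 < (v j).re := by
    intro j
    by_cases h : j = i
    · subst h; simp [hv]; linarith [hw j]
    · simpa [hv, h] using hw j
  have hwi : w i ≠ 0 := fun h => by simpa [h] using hw i
  have hint : ∫ y, w i * mellinIntegrand f w y ∂orthantMeasure ι =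
      ∫ y, mellinIntegrand g v y ∂orthantMeasure ι := by
    refine integral_orthant_congr_of_update i ((hf.integrable_mellinIntegrand hε hw).const_mul _)
      (hg.integrable_mellinIntegrand hε hv_re) fun y hy => ?_
    obtain ⟨C, hC, hfb⟩ := hf.bound
    obtain ⟨C', hC', hgb⟩ := hg.bound
    set P : ℂ := ∏ j ∈ Finset.univ.erase i, (y j : ℂ) ^ (w j - 1) with hP
    have hprod (w' : ι → ℂ) (x : ℝ) (hw' : ∀ j, j ≠ i → w' j = w j) :
        ∏ j, ((Function.update y i x j : ℝ) : ℂ) ^ (w' j - 1) = (x : ℂ) ^ (w' i - 1) * P := by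
      rw [← Finset.mul_prod_erase _ _ (Finset.mem_univ i), Function.update_self, hP]
      congr 1
      refine Finset.prod_congr rfl fun j hj => ?_
      have hj' := Finset.ne_of_mem_erase hj
      rw [Function.update_of_ne hj', hw' j hj']
    have hpos {x : ℝ} (hx : 0 < x) (j : ι) : 0 < Function.update y i x j := by
      by_cases h : j = i
      · subst h; simpa using hx
      · simpa [h] using hy j
    have hexp {x : ℝ} (hx : 0 < x) :
        Real.exp (-ε * ∑ j, Function.update y i x j) ≤ Real.exp (-ε * x) := by
      have := Finset.single_le_sum (fun j _ => (hpos hx j).le) (Finset.mem_univ i)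
      rw [Function.update_self] at this
      exact Real.exp_le_exp.2 (by nlinarith)
    have hup : Measurable fun x : ℝ => Function.update y i x := measurable_update y
    have hpart := integral_mul_cpow_sub_one_mul (hw i) hε (C := C + C')
      (φ := fun x => f (Function.update y i x)) (ψ := fun x => g (Function.update y i x))
      (hf.measurable.comp hup) (hg.measurable.comp hup)
      (fun x hx => (hfb _ (hpos hx)).trans
        (mul_le_mul (by linarith) (hexp hx) (Real.exp_pos _).le (by linarith)))
      (fun x hx => (hgb _ (hpos hx)).trans
        (mul_le_mul (by linarith) (hexp hx) (Real.exp_pos _).le (by linarith)))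
      (fun x hx => by
        simpa using hd _ (hpos hx))
    calc _ = P * ∫ x in Ioi (0 : ℝ), (w i * (x : ℂ) ^ (w i - 1)) * f (Function.update y i x) := by
          rw [← integral_const_mul]
          refine integral_congr_ae (Eventually.of_forall fun x => ?_)
          simp only [mellinIntegrand]
          rw [hprod w x fun _ _ => rfl]
          ring
      _ = P * ∫ x in Ioi (0 : ℝ), (x : ℂ) ^ (w i) * g (Function.update y i x) := by rw [hpart]
      _ = _ := by
          rw [← integral_const_mul]
          refine integral_congr_ae (Eventually.of_forall fun x => ?_)
          simp only [mellinIntegrand]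
          rw [hprod v x fun j hj => by simp [hv, hj]]
          simp only [hv, Function.update_self, add_sub_cancel_right]
          ring
  rw [integral_const_mul] at hint
  rw [gammaMellin, gammaMellin, ← hint, ← Finset.mul_prod_erase _ _ (Finset.mem_univ i),
    ← Finset.mul_prod_erase _ (fun j => 1 / Complex.Gamma (v j)) (Finset.mem_univ i)]
  have : ∏ j ∈ Finset.univ.erase i, 1 / Complex.Gamma (v j) =
      ∏ j ∈ Finset.univ.erase i, 1 / Complex.Gamma (w j) :=
    Finset.prod_congr rfl fun j hj => by simp [hv, Finset.ne_of_mem_erase hj]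
  rw [this]
  -- The factor `w i` from differentiating the power is absorbed by Γ(w+1) = w Γ(w).
  have hΓ : Complex.Gamma (w i) ≠ 0 := Complex.Gamma_ne_zero_of_re_pos (hw i)
  simp only [hv, Function.update_self, Complex.Gamma_add_one _ hwi]
  field_simp

/-- A family of exponentially decaying functions that is closed under partial derivatives, up to
sign, on the positive orthant. -/
structure IsDerivClosed [DecidableEq ι] (ε : ℝ) (D : Set ((ι → ℝ) → ℂ)) : Prop where
  decaying : ∀ f ∈ D, IsExpDecaying ε f
  deriv : ∀ f ∈ D, ∀ i, ∃ g ∈ D, ∀ y, (∀ j, 0 < y j) →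
    HasDerivAt (fun x => f (Function.update y i x)) (-g y) (y i)

variable [DecidableEq ι]

/-- One integration by parts per coordinate of `s`; the shifts only increase the real parts, so the
positivity condition persists through the induction. -/
theorem IsDerivClosed.exists_gammaMellin_shift_finset {ε : ℝ} (hε : 0 < ε)
    {D : Set ((ι → ℝ) → ℂ)} (hD : IsDerivClosed ε D) {f : (ι → ℝ) → ℂ} (hf : f ∈ D)
    (s : Finset ι) : ∃ g ∈ D, ∀ w : ι → ℂ, (∀ j, 0 < (w j).re) →
      gammaMellin f w = gammaMellin g (fun j => w j + if j ∈ s then 1 else 0) := by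
  induction s using Finset.induction_on with
  | empty => exact ⟨f, hf, fun w _ => by simp⟩
  | insert i s hi ih =>
    obtain ⟨g, hg, hfg⟩ := ih
    obtain ⟨k, hk, hgk⟩ := hD.deriv g hg i
    refine ⟨k, hk, fun w hw => ?_⟩
    rw [hfg w hw, gammaMellin_eq_of_hasDerivAt hε (hD.decaying g hg) (hD.decaying k hk) i hgk]
    · congr 1
      ext j
      by_cases h : j = i
      · subst h; simp [hi]
      · simp [h]
    · intro j
      have := hw j
      split_ifs <;> simp <;> linarith

theorem IsDerivClosed.exists_gammaMellin_shift {ε : ℝ} (hε : 0 < ε)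
    {D : Set ((ι → ℝ) → ℂ)} (hD : IsDerivClosed ε D) (f : D) :
    ∃ g : D, ∀ w : ι → ℂ, (∀ j, 0 < (w j).re) →
      gammaMellin f.1 w = gammaMellin g.1 (fun j => w j + 1) := by
  obtain ⟨g, hg, h⟩ := hD.exists_gammaMellin_shift_finset hε f.2 Finset.univ
  exact ⟨⟨g, hg⟩, by simpa using h⟩

/-- The normalized Mellin transform of a member of such a family extends to an entire function. -/
theorem IsDerivClosed.exists_entire_gammaMellin {ε : ℝ} (hε : 0 < ε)
    {D : Set ((ι → ℝ) → ℂ)} (hD : IsDerivClosed ε D) {f : (ι → ℝ) → ℂ} (hf : f ∈ D) :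
    ∃ F : (ι → ℂ) → ℂ, Differentiable ℂ F ∧
      ∀ w : ι → ℂ, (∀ j, 0 < (w j).re) → F w = gammaMellin f w := by
  choose next hnext using hD.exists_gammaMellin_shift hε
  -- After k rounds of shifting, `G k` is holomorphic where all Re w_j > -k, and each `G (k + 1)`
  -- extends `G k`.
  let s : ℕ → D := fun k => next^[k] ⟨f, hf⟩
  let G : ℕ → (ι → ℂ) → ℂ := fun k w => gammaMellin (s k).1 fun j => w j + k
  have hstep (k : ℕ) (w : ι → ℂ) (hw : ∀ j, -(k : ℝ) < (w j).re) : G (k + 1) w = G k w := by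
    have := hnext (s k) (fun j => w j + k) fun j => by simpa using by linarith [hw j]
    simp only [G]
    rw [this]
    simp only [s, Function.iterate_succ_apply', Nat.cast_add, Nat.cast_one, add_assoc]
  have hle (k l : ℕ) (hkl : k ≤ l) (w : ι → ℂ) (hw : ∀ j, -(k : ℝ) < (w j).re) :
      G l w = G k w := by
    induction l, hkl using Nat.le_induction with
    | base => rfl
    | succ l hl ih =>
      have : (k : ℝ) ≤ l := by exact_mod_cast hl
      rw [hstep l w fun j => by linarith [hw j], ih]
  have hdiff (k : ℕ) (w : ι → ℂ) (hw : ∀ j, -(k : ℝ) < (w j).re) :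
      DifferentiableAt ℂ (G k) w := by
    refine DifferentiableAt.comp (g := gammaMellin (s k).1) (f := fun w : ι → ℂ => fun j => w j + k)
      w ((hD.decaying _ (s k).2).differentiableAt_gammaMellin hε fun j => ?_) (by fun_prop)
    simpa using by linarith [hw j]
  -- The level is taken larger than ‖w‖, so the fixed level `K w` remains admissible in a
  -- neighbourhood of `w`, and differentiability can be checked there on `G (K w)`.
  let K : (ι → ℂ) → ℕ := fun w => ⌈‖w‖⌉₊ + 1
  have hK (w : ι → ℂ) (k : ℕ) (hk : ‖w‖ < k) (j : ι) : -(k : ℝ) < (w j).re := by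
    have := (abs_le.1 (re_le_norm_pi w j)).1
    linarith
  have hKw (w : ι → ℂ) : ‖w‖ < K w := by
    have := Nat.le_ceil ‖w‖
    simp only [K, Nat.cast_add, Nat.cast_one]
    linarith
  have hG (w : ι → ℂ) (k : ℕ) (hk : ∀ j, -(k : ℝ) < (w j).re) : G (K w) w = G k w := by
    rcases le_total k (K w) with h | h
    · exact hle _ _ h w hk
    · exact (hle _ _ h w (hK w _ (hKw w))).symm
  refine ⟨fun w => G (K w) w, fun w => ?_, fun w hw => ?_⟩
  · have hev : (fun v => G (K v) v) =ᶠ[𝓝 w] G (K w) := by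
      have hn : ∀ᶠ v in 𝓝 w, ‖v‖ < K w :=
        continuous_norm.continuousAt.eventually_lt continuousAt_const (hKw w)
      filter_upwards [hn] with v hv
      exact hG v _ (hK v _ hv)
    exact (hdiff _ w (hK w _ (hKw w))).congr_of_eventuallyEq hev
  · change G (K w) w = _
    rw [hG w 0 (by simpa using hw)]
    simp [G, s]

end

/-! ### The polylogarithm kernel and its Mellin transform on the cut domain. -/

section
variable {r : ℕ}

theorem hasSum_pi_prod {f : Fin r → ℕ → ℂ} {a : Fin r → ℂ} (hf : ∀ j, HasSum (f j) (a j))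
    (hn : ∀ j, Summable fun k => ‖f j k‖) :
    HasSum (fun n : Fin r → ℕ => ∏ j, f j (n j)) (∏ j, a j) ∧
      Summable fun n : Fin r → ℕ => ‖∏ j, f j (n j)‖ := by
  induction r with
  | zero =>
    refine ⟨?_, (hasSum_fintype _).summable⟩
    simp
  | succ r ih =>
    obtain ⟨h1, h2⟩ := ih (fun j => hf j.succ) (fun j => hn j.succ)
    let e := Fin.consEquiv fun _ : Fin (r + 1) => ℕ
    have he : (fun n : Fin (r + 1) → ℕ => ∏ j, f j (n j)) ∘ e =
        fun p => f 0 p.1 * ∏ j : Fin r, f j.succ (p.2 j) := by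
      ext p
      simp [e, Fin.consEquiv, Fin.prod_univ_succ]
    have hs : Summable fun p : ℕ × (Fin r → ℕ) => ‖f 0 p.1 * ∏ j : Fin r, f j.succ (p.2 j)‖ :=
      Summable.mul_norm (f := f 0) (g := fun n : Fin r → ℕ => ∏ j : Fin r, f j.succ (n j)) (hn 0) h2
    constructor
    · rw [← e.hasSum_iff, he, Fin.prod_univ_succ]
      exact HasSum.mul (f := f 0) (g := fun n : Fin r → ℕ => ∏ j : Fin r, f j.succ (n j))
        (hf 0) h1 hs.of_norm
    · rw [← e.summable_iff]
      have : (fun n : Fin (r + 1) → ℕ => ‖∏ j, f j (n j)‖) ∘ e =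
          fun p => ‖f 0 p.1 * ∏ j : Fin r, f j.succ (p.2 j)‖ := by
        ext p
        simpa using congrArg norm (congrFun he p)
      rwa [this]

theorem tailSum_zero [NeZero r] (t : Fin r → ℝ) : tailSum t 0 = ∑ i, t i := by
  rw [tailSum]
  congr 1
  ext i; simp

theorem tailSum_pos {t : Fin r → ℝ} (ht : ∀ i, 0 < t i) (j : Fin r) : 0 < tailSum t j :=
  Finset.sum_pos (fun i _ => ht i) ⟨j, by simp⟩

theorem tailSum_le_tailSum_zero [NeZero r] {t : Fin r → ℝ} (ht : ∀ i, 0 < t i) (j : Fin r) :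
    tailSum t j ≤ tailSum t 0 := by
  rw [tailSum_zero]
  exact Finset.sum_le_sum_of_subset_of_nonneg (Finset.subset_univ _) fun i _ _ => (ht i).le

@[fun_prop]
theorem continuous_tailSum (j : Fin r) : Continuous fun t => tailSum t j := by
  unfold tailSum
  fun_prop

/-- This exchange of summation turns ∏ exp(-l_j X_j) into ∏ exp(-(l_1+⋯+l_j) x_j), which is where
the partial sums in the polylogarithm denominators come from. -/
theorem sum_mul_tailSum (l : Fin r → ℝ) (t : Fin r → ℝ) :
    ∑ j, l j * tailSum t j = ∑ j, (∑ i ∈ Finset.Iic j, l i) * t j := by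
  simp only [tailSum, Finset.mul_sum, Finset.sum_mul]
  rw [Finset.sum_comm' (t' := Finset.univ) (s' := fun j => Finset.Iic j)]
  simp

/-- The function whose normalized Mellin transform is the polylogarithm. -/
noncomputable def polylogKernel (b : Fin r → ℕ) (z : Fin r → ℂ) (x : Fin r → ℝ) : ℂ :=
  ∏ j, (z j ^ b j * (Real.exp ((1 - (b j : ℝ)) * tailSum x j) : ℂ) /
    ((Real.exp (tailSum x j) : ℂ) - z j))

theorem measurable_polylogKernel (b : Fin r → ℕ) (z : Fin r → ℂ) :
    Measurable (polylogKernel b z) := by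
  unfold polylogKernel
  have (j : Fin r) : Measurable fun x : Fin r → ℝ => tailSum x j :=
    (continuous_tailSum j).measurable
  fun_prop

/-- Near `ζ₀` the distance N from ζ to e^X is at least half the distance d from `ζ₀` to [1,∞). For
‖ζ‖ ≤ M this gives e^X ≤ N + M and M ≤ (2M/d) N. The further summand M in the constant also makes it
bound ‖ζ‖. -/
theorem exists_exp_le_mul_norm_sub {ζ₀ : ℂ} (hζ : ∀ x : ℝ, 1 ≤ x → ζ₀ ≠ x) :
    ∃ C, 0 ≤ C ∧ ∀ᶠ ζ in 𝓝 ζ₀, ‖ζ‖ ≤ C ∧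
      ∀ X : ℝ, 0 ≤ X → Real.exp X ≤ C * ‖(Real.exp X : ℂ) - ζ‖ := by
  set S : Set ℂ := (fun x : ℝ => (x : ℂ)) '' Ici 1 with hS
  have hSc : IsClosed S := Complex.isometry_ofReal.isClosedEmbedding.isClosedMap _ isClosed_Ici
  have hSn : S.Nonempty := ⟨1, 1, by simp, by simp⟩
  have hmem : ζ₀ ∉ S := by
    rintro ⟨x, hx, rfl⟩
    exact hζ x hx rfl
  set d := infDist ζ₀ S with hd
  have hd0 : 0 < d := (hSc.notMem_iff_infDist_pos hSn).1 hmem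
  set M := ‖ζ₀‖ + d / 2 with hM
  have hM0 : 0 ≤ M := by positivity
  refine ⟨M + (1 + 2 * M / d), by positivity, ?_⟩
  filter_upwards [ball_mem_nhds ζ₀ (half_pos hd0)] with ζ hb
  have hb' : ‖ζ - ζ₀‖ < d / 2 := by rwa [mem_ball_iff_norm] at hb
  have hζM : ‖ζ‖ ≤ M := by
    have : ‖ζ‖ ≤ ‖ζ₀‖ + ‖ζ - ζ₀‖ := norm_le_insert' ζ ζ₀
    linarith
  have hq : 0 ≤ 2 * M / d := by positivity
  refine ⟨by linarith, fun X hX => ?_⟩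
  set N := ‖(Real.exp X : ℂ) - ζ‖ with hN
  have hNd : d / 2 ≤ N := by
    have h1 : d ≤ dist ζ₀ (Real.exp X : ℂ) :=
      infDist_le_dist_of_mem ⟨Real.exp X, Real.one_le_exp hX, rfl⟩
    have h2 : dist ζ₀ (Real.exp X : ℂ) ≤ dist ζ₀ ζ + dist ζ (Real.exp X : ℂ) := dist_triangle _ _ _
    rw [dist_comm ζ₀ ζ, dist_eq_norm ζ, dist_comm ζ, dist_eq_norm (Real.exp X : ℂ)] at h2
    linarith
  have hXN : Real.exp X ≤ N + M := by
    have : ‖(Real.exp X : ℂ)‖ ≤ ‖ζ‖ + ‖(Real.exp X : ℂ) - ζ‖ := norm_le_insert' _ _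
    rw [Complex.norm_real, Real.norm_of_nonneg (Real.exp_pos X).le] at this
    linarith
  have hMN : M ≤ 2 * M / d * N := by
    calc M = 2 * M / d * (d / 2) := by field_simp
      _ ≤ _ := mul_le_mul_of_nonneg_left hNd hq
  have hN0 : 0 ≤ M * N := mul_nonneg hM0 (norm_nonneg _)
  linarith

/-- The j-th factor is O(exp(-b_j X_j)). Since X_0 is the full sum of the x_i, the condition b_0 ≥ 1
alone supplies the decay. -/
theorem norm_polylogKernel_le [NeZero r] {b : Fin r → ℕ} (hb : 1 ≤ b 0) {z : Fin r → ℂ}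
    {C : Fin r → ℝ} (hC : ∀ j, ‖z j‖ ≤ C j)
    (hz : ∀ j, ∀ X : ℝ, 0 ≤ X → Real.exp X ≤ C j * ‖(Real.exp X : ℂ) - z j‖)
    {x : Fin r → ℝ} (hx : ∀ i, 0 < x i) :
    ‖polylogKernel b z x‖ ≤ (∏ j, C j ^ (b j + 1)) * Real.exp (-1 * ∑ i, x i) := by
  have hC0 (j : Fin r) : 0 ≤ C j := (norm_nonneg _).trans (hC j)
  have hfac (j : Fin r) : ‖z j ^ b j * (Real.exp ((1 - (b j : ℝ)) * tailSum x j) : ℂ) /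
      ((Real.exp (tailSum x j) : ℂ) - z j)‖ ≤ C j ^ (b j + 1) * Real.exp (-(b j * tailSum x j)) := by
    have hX := hz j _ (tailSum_pos hx j).le
    set N := ‖(Real.exp (tailSum x j) : ℂ) - z j‖ with hN
    have hN0 : 0 < N := by
      rcases (norm_nonneg ((Real.exp (tailSum x j) : ℂ) - z j)).eq_or_lt with h | h
      · rw [← hN] at h
        rw [← h, mul_zero] at hX
        exact absurd hX (not_le.2 (Real.exp_pos _))
      · exact h
    rw [norm_div, norm_mul, norm_pow, Complex.norm_real, Real.norm_of_nonneg (Real.exp_pos _).le,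
      div_le_iff₀ hN0]
    have he : Real.exp ((1 - (b j : ℝ)) * tailSum x j) =
        Real.exp (-(b j * tailSum x j)) * Real.exp (tailSum x j) := by
      rw [← Real.exp_add]; ring_nf
    rw [he]
    calc _ ≤ C j ^ b j * (Real.exp (-(b j * tailSum x j)) * (C j * N)) := by
          refine mul_le_mul (pow_le_pow_left₀ (norm_nonneg _) (hC j) _)
            (mul_le_mul_of_nonneg_left hX (Real.exp_pos _).le) (by positivity)
            (pow_nonneg (hC0 j) _)
      _ = _ := by ring
  rw [polylogKernel, norm_prod]
  refine (Finset.prod_le_prod (fun _ _ => norm_nonneg _) fun j _ => hfac j).trans ?_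
  rw [Finset.prod_mul_distrib, ← Real.exp_sum]
  refine mul_le_mul_of_nonneg_left (Real.exp_le_exp.2 ?_)
    (Finset.prod_nonneg fun j _ => pow_nonneg (hC0 j) _)
  rw [Finset.sum_neg_distrib, ← tailSum_zero x]
  have h1 : (b 0 : ℝ) * tailSum x 0 ≤ ∑ j, (b j : ℝ) * tailSum x j :=
    Finset.single_le_sum (f := fun j => (b j : ℝ) * tailSum x j)
      (fun j _ => mul_nonneg (Nat.cast_nonneg _) (tailSum_pos hx j).le) (Finset.mem_univ 0)
  have h2 : (1 : ℝ) ≤ b 0 := by exact_mod_cast hb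
  have h3 := tailSum_pos hx 0
  nlinarith

theorem exists_ball_norm_polylogKernel_le [NeZero r] {b : Fin r → ℕ} (hb : 1 ≤ b 0)
    {z₀ : Fin r → ℂ} (hz₀ : z₀ ∈ cutDomain r) :
    ∃ R > 0, ∃ C, 0 ≤ C ∧ ball z₀ R ⊆ cutDomain r ∧ ∀ z ∈ ball z₀ R, ∀ x : Fin r → ℝ,
      (∀ i, 0 < x i) → ‖polylogKernel b z x‖ ≤ C * Real.exp (-1 * ∑ i, x i) := by
  choose C hC0 hC using fun j => exists_exp_le_mul_norm_sub (hz₀ j)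
  have hev : ∀ᶠ z in 𝓝 z₀, ∀ j, ‖z j‖ ≤ C j ∧
      ∀ X : ℝ, 0 ≤ X → Real.exp X ≤ C j * ‖(Real.exp X : ℂ) - z j‖ :=
    eventually_all.2 fun j => (continuous_apply j).continuousAt.eventually (hC j)
  obtain ⟨R, hR, h⟩ := eventually_nhds_iff_ball.1 hev
  refine ⟨R, hR, ∏ j, C j ^ (b j + 1), Finset.prod_nonneg fun j _ => pow_nonneg (hC0 j) _,
    fun z hz j x hx hzx => ?_, fun z hz x hx =>
    norm_polylogKernel_le hb (fun j => (h z hz j).1) (fun j => (h z hz j).2) hx⟩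
  -- If z_j = x ≥ 1, the estimate at X = log x would bound x by 0.
  have := (h z hz j).2 (Real.log x) (Real.log_nonneg hx)
  rw [Real.exp_log (by linarith), hzx, sub_self, norm_zero, mul_zero] at this
  linarith

theorem isOpen_cutDomain [NeZero r] : IsOpen (cutDomain r) := by
  rw [Metric.isOpen_iff]
  intro z hz
  obtain ⟨R, hR, -, -, h, -⟩ := exists_ball_norm_polylogKernel_le (b := fun _ => 1) le_rfl hz
  exact ⟨R, hR, h⟩

theorem starConvex_cutDomain : StarConvex ℝ 0 (cutDomain r) := by
  rw [starConvex_zero_iff]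
  intro z hz t ht0 ht1 j x hx h
  have ht : t ≠ 0 := by
    rintro rfl
    have : (x : ℂ) = 0 := by simpa using h.symm
    have : x = 0 := by exact_mod_cast this
    linarith
  have htpos : 0 < t := lt_of_le_of_ne ht0 ht.symm
  refine hz j (x / t) ((le_div_iff₀ htpos).2 (by linarith)) ?_
  have : (t : ℂ) * z j = x := by simpa using h
  push_cast
  rw [eq_div_iff (by exact_mod_cast ht), mul_comm, this]

theorem zero_mem_cutDomain : (0 : Fin r → ℂ) ∈ cutDomain r := by
  intro j x hx h
  have : (x : ℂ) = 0 := by simpa using h.symm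
  have : x = 0 := by exact_mod_cast this
  linarith

theorem unitPolydisc_mem_nhds : unitPolydisc r ∈ 𝓝 (0 : Fin r → ℂ) := by
  filter_upwards [ball_mem_nhds (0 : Fin r → ℂ) one_pos] with z hz j
  exact (norm_le_pi_norm z j).trans_lt (by simpa using hz)

theorem differentiableOn_gammaMellin_polylogKernel [NeZero r] {b : Fin r → ℕ} (hb : 1 ≤ b 0)
    {u : Fin r → ℂ} (hu : ∀ j, 0 < (u j).re) :
    DifferentiableOn ℂ (fun z => gammaMellin (polylogKernel b z) u) (cutDomain r) := by
  intro z₀ hz₀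
  refine DifferentiableAt.differentiableWithinAt ?_
  obtain ⟨R, hR, C, hC, hsub, h⟩ := exists_ball_norm_polylogKernel_le hb hz₀
  obtain ⟨δ, hδ, hδu⟩ := exists_pos_lt_re hu
  unfold gammaMellin
  refine DifferentiableAt.const_mul ?_ _
  refine differentiableAt_integral_of_norm_le hR
    (bound := fun y => C * mellinBound (Fin r) δ (‖u‖ + 1) 1 y)
    (fun z _ => (measurable_mellinIntegrand (measurable_polylogKernel b z) u).aestronglyMeasurable)
    ?_ ?_ ((integrable_mellinBound hδ (by positivity) one_pos).const_mul C)
  · filter_upwards [ae_orthantMeasure_pos] with x hx z hz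
    refine DifferentiableAt.differentiableWithinAt ?_
    unfold mellinIntegrand polylogKernel
    refine DifferentiableAt.const_mul (differentiableAt_prod _ fun j _ => ?_) _
    have hne : (Real.exp (tailSum x j) : ℂ) - z j ≠ 0 := sub_ne_zero.2 fun h => ?_
    · have h1 : DifferentiableAt ℂ (fun z : Fin r → ℂ =>
          z j ^ b j * (Real.exp ((1 - (b j : ℝ)) * tailSum x j) : ℂ)) z := by fun_prop
      have h2 : DifferentiableAt ℂ (fun z : Fin r → ℂ => (Real.exp (tailSum x j) : ℂ) - z j) z := by
        fun_prop
      have h3 := DifferentiableAt.mul h1 (h2.inv hne)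
      simp only [div_eq_mul_inv]
      exact h3
    exact hsub hz j _ (Real.one_le_exp (tailSum_pos hx j).le) h.symm
  · filter_upwards [ae_orthantMeasure_pos] with x hx z hz
    exact norm_mellinIntegrand_le (h z hz) (fun i => (hδu i).le)
      (fun i => by linarith [le_abs_self (u i).re, re_le_norm_pi u i]) hx

end

/-! ### Termwise Mellin transform of the polylogarithm series. -/

section
variable {r : ℕ}

/-- The function whose normalized Mellin transform is a term of the polylogarithm series. -/
noncomputable def polylogTermKernel (b : Fin r → ℕ) (z : Fin r → ℂ) (n : Fin r → ℕ)
    (x : Fin r → ℝ) : ℂ :=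
  ∏ j, (z j ^ (n j + b j) * (Real.exp (-((n j + b j : ℕ) * tailSum x j)) : ℂ))

theorem measurable_polylogTermKernel (b : Fin r → ℕ) (z : Fin r → ℂ) (n : Fin r → ℕ) :
    Measurable (polylogTermKernel b z n) := by
  unfold polylogTermKernel
  have (j : Fin r) : Measurable fun x : Fin r → ℝ => tailSum x j :=
    (continuous_tailSum j).measurable
  fun_prop

theorem norm_polylogTermKernel_le [NeZero r] {b : Fin r → ℕ} (hb : 1 ≤ b 0) {z : Fin r → ℂ}
    (hz : z ∈ unitPolydisc r) (n : Fin r → ℕ) {x : Fin r → ℝ} (hx : ∀ i, 0 < x i) :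
    ‖polylogTermKernel b z n x‖ ≤ (∏ j, ‖z j‖ ^ n j) * Real.exp (-1 * ∑ i, x i) := by
  rw [polylogTermKernel, norm_prod]
  have hfac (j : Fin r) :
      ‖z j ^ (n j + b j) * (Real.exp (-((n j + b j : ℕ) * tailSum x j)) : ℂ)‖ ≤
        ‖z j‖ ^ n j * Real.exp (-((n j + b j : ℕ) * tailSum x j)) := by
    rw [norm_mul, norm_pow, Complex.norm_real, Real.norm_of_nonneg (Real.exp_pos _).le]
    exact mul_le_mul_of_nonneg_right
      (pow_le_pow_of_le_one (norm_nonneg _) (hz j).le (Nat.le_add_right _ _)) (Real.exp_pos _).le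
  refine (Finset.prod_le_prod (fun _ _ => norm_nonneg _) fun j _ => hfac j).trans ?_
  rw [Finset.prod_mul_distrib, ← Real.exp_sum]
  refine mul_le_mul_of_nonneg_left (Real.exp_le_exp.2 ?_)
    (Finset.prod_nonneg fun j _ => pow_nonneg (norm_nonneg _) _)
  rw [Finset.sum_neg_distrib, ← tailSum_zero x]
  have h1 : ((n 0 + b 0 : ℕ) : ℝ) * tailSum x 0 ≤ ∑ j, ((n j + b j : ℕ) : ℝ) * tailSum x j :=
    Finset.single_le_sum (f := fun j => ((n j + b j : ℕ) : ℝ) * tailSum x j)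
      (fun j _ => mul_nonneg (Nat.cast_nonneg _) (tailSum_pos hx j).le) (Finset.mem_univ 0)
  have h2 : (1 : ℝ) ≤ ((n 0 + b 0 : ℕ) : ℝ) := by exact_mod_cast hb.trans (Nat.le_add_left _ _)
  have h3 := tailSum_pos hx 0
  nlinarith

/-- In each coordinate this is a geometric series in z_j exp(-X_j), of norm < 1, starting at the
exponent b_j. -/
theorem hasSum_polylogTermKernel {b : Fin r → ℕ} {z : Fin r → ℂ} (hz : z ∈ unitPolydisc r)
    {x : Fin r → ℝ} (hx : ∀ i, 0 < x i) :
    HasSum (fun n => polylogTermKernel b z n x) (polylogKernel b z x) := by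
  let q : Fin r → ℂ := fun j => z j * (Real.exp (-tailSum x j) : ℂ)
  have hq (j : Fin r) : ‖q j‖ < 1 := by
    rw [norm_mul, Complex.norm_real, Real.norm_of_nonneg (Real.exp_pos _).le]
    have h1 : Real.exp (-tailSum x j) ≤ 1 := Real.exp_le_one_iff.2 (by linarith [tailSum_pos hx j])
    calc _ ≤ ‖z j‖ * 1 := mul_le_mul_of_nonneg_left h1 (norm_nonneg _)
      _ < 1 := by rw [mul_one]; exact hz j
  have hterm (j : Fin r) (k : ℕ) :
      z j ^ (k + b j) * (Real.exp (-((k + b j : ℕ) * tailSum x j)) : ℂ) = q j ^ b j * q j ^ k := by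
    have : (Real.exp (-((k + b j : ℕ) * tailSum x j)) : ℂ) =
        (Real.exp (-tailSum x j) : ℂ) ^ (k + b j) := by
      rw [← Complex.ofReal_pow, ← Real.exp_nat_mul]
      congr 2
      ring
    rw [this, ← mul_pow, pow_add, mul_comm]
  have hsum (j : Fin r) : HasSum (fun k => q j ^ b j * q j ^ k)
      (z j ^ b j * (Real.exp ((1 - (b j : ℝ)) * tailSum x j) : ℂ) /
        ((Real.exp (tailSum x j) : ℂ) - z j)) := by
    have h := (hasSum_geometric_of_norm_lt_one (hq j)).mul_left (q j ^ b j)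
    convert! h using 1
    set E : ℂ := (Real.exp (tailSum x j) : ℂ) with hE
    have hE0 : E ≠ 0 := by
      rw [hE]; exact_mod_cast (Real.exp_pos _).ne'
    have he1 : (Real.exp (-tailSum x j) : ℂ) = E⁻¹ := by
      rw [hE, Real.exp_neg]; push_cast; rfl
    have he2 : (Real.exp ((1 - (b j : ℝ)) * tailSum x j) : ℂ) = E * (E⁻¹) ^ b j := by
      rw [← he1, hE, ← Complex.ofReal_pow, ← Real.exp_nat_mul, ← Complex.ofReal_mul,
        ← Real.exp_add]
      congr 2
      ring
    have hne : (1 : ℂ) - q j ≠ 0 := by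
      intro h0
      have := hq j
      rw [← sub_eq_zero.1 h0] at this
      simp at this
    have hsub : E - z j = E * (1 - q j) := by
      simp only [q, he1]
      field_simp
    rw [hsub, he2]
    simp only [q, he1, mul_pow]
    simp only [q, he1] at hne
    field_simp
  have := (hasSum_pi_prod (f := fun j k => q j ^ b j * q j ^ k) hsum fun j => ?_).1
  · simpa only [polylogTermKernel, hterm, polylogKernel] using this
  · simp only [norm_mul, norm_pow]
    exact (summable_geometric_of_lt_one (norm_nonneg _) (hq j)).mul_left _

theorem gammaMellin_polylogTermKernel [NeZero r] {b : Fin r → ℕ} (hb : 1 ≤ b 0) {u : Fin r → ℂ}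
    (hu : ∀ j, 0 < (u j).re) (z : Fin r → ℂ) (n : Fin r → ℕ) :
    gammaMellin (polylogTermKernel b z n) u = polylogTerm u z b n := by
  let N : Fin r → ℕ := fun j => ∑ i ∈ Finset.Iic j, (n i + b i)
  -- Every partial sum contains the index 0, and b_0 ≥ 1; so the Gamma integrals converge.
  have hN (j : Fin r) : 0 < N j := by
    refine Finset.sum_pos' (fun _ _ => Nat.zero_le _) ⟨0, by simp, ?_⟩
    omega
  have hK (x : Fin r → ℝ) : mellinIntegrand (polylogTermKernel b z n) u x =
      (∏ j, z j ^ (n j + b j)) *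
        ∏ j, ((x j : ℂ) ^ (u j - 1) * Complex.exp (-((N j : ℝ) * x j))) := by
    have hexp : ∏ j, (Real.exp (-((n j + b j : ℕ) * tailSum x j)) : ℂ) =
        ∏ j, Complex.exp (-((N j : ℝ) * x j)) := by
      rw [← Complex.exp_sum, ← Complex.ofReal_prod, ← Real.exp_sum, Complex.ofReal_exp]
      congr 1
      rw [Finset.sum_neg_distrib, sum_mul_tailSum (fun j => ((n j + b j : ℕ) : ℝ)) x]
      simp [N]
    rw [mellinIntegrand, polylogTermKernel, Finset.prod_mul_distrib, hexp,
      Finset.prod_mul_distrib]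
    ring
  rw [gammaMellin]
  simp only [hK]
  rw [integral_const_mul, orthantMeasure,
    integral_fintype_prod_eq_prod (fun j (t : ℝ) =>
      (t : ℂ) ^ (u j - 1) * Complex.exp (-((N j : ℝ) * t)))]
  have hI (j : Fin r) : ∫ t in Ioi (0 : ℝ), (t : ℂ) ^ (u j - 1) *
      Complex.exp (-((N j : ℝ) * t)) = Complex.Gamma (u j) * ((N j : ℂ) ^ u j)⁻¹ := by
    have hNj : (0 : ℝ) < N j := by exact_mod_cast hN j
    rw [Complex.integral_cpow_mul_exp_neg_mul_Ioi (hu j) hNj, one_div, Complex.inv_cpow]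
    · simp [mul_comm]
    · rw [Complex.arg_ofReal_of_nonneg hNj.le]
      exact Real.pi_pos.ne
  simp only [hI]
  rw [polylogTerm, Finset.prod_mul_distrib, div_eq_mul_inv, ← Finset.prod_inv_distrib]
  have hΓ : (∏ j, 1 / Complex.Gamma (u j)) * ∏ j, Complex.Gamma (u j) = 1 := by
    rw [← Finset.prod_mul_distrib]
    exact Finset.prod_eq_one fun j _ =>
      one_div_mul_cancel (Complex.Gamma_ne_zero_of_re_pos (hu j))
  calc _ = ((∏ j, 1 / Complex.Gamma (u j)) * ∏ j, Complex.Gamma (u j)) *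
        ((∏ j, z j ^ (n j + b j)) * ∏ j, ((N j : ℂ) ^ u j)⁻¹) := by ring
    _ = _ := by rw [hΓ, one_mul]

/-- The polylogarithm series converges to the normalized Mellin transform of its kernel. -/
theorem hasSum_polylogTerm [NeZero r] {b : Fin r → ℕ} (hb : 1 ≤ b 0) {u : Fin r → ℂ}
    (hu : ∀ j, 0 < (u j).re) {z : Fin r → ℂ} (hz : z ∈ unitPolydisc r) :
    HasSum (polylogTerm u z b) (gammaMellin (polylogKernel b z) u) := by
  obtain ⟨δ, hδ, hδu⟩ := exists_pos_lt_re hu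
  have hB := integrable_mellinBound (ι := Fin r) (ρ := ‖u‖ + 1) hδ (by positivity) one_pos
  have hle (n : Fin r → ℕ) : ∀ᵐ x ∂orthantMeasure (Fin r),
      ‖mellinIntegrand (polylogTermKernel b z n) u x‖ ≤
        (∏ j, ‖z j‖ ^ n j) * mellinBound (Fin r) δ (‖u‖ + 1) 1 x := by
    filter_upwards [ae_orthantMeasure_pos] with x hx
    exact norm_mellinIntegrand_le (fun y hy => norm_polylogTermKernel_le hb hz n hy)
      (fun i => (hδu i).le) (fun i => by linarith [le_abs_self (u i).re, re_le_norm_pi u i]) hx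
  have hint (n : Fin r → ℕ) : Integrable (mellinIntegrand (polylogTermKernel b z n) u)
      (orthantMeasure (Fin r)) :=
    (hB.const_mul _).mono' (measurable_mellinIntegrand
      (measurable_polylogTermKernel b z n) u).aestronglyMeasurable (hle n)
  have hgeom : Summable fun n : Fin r → ℕ => ∏ j, ‖z j‖ ^ n j := by
    have := (hasSum_pi_prod (f := fun j k => z j ^ k)
      (fun j => hasSum_geometric_of_norm_lt_one (hz j)) fun j => by
        simpa only [norm_pow] using summable_geometric_of_lt_one (norm_nonneg _) (hz j)).2
    simpa only [norm_prod, norm_pow] using this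
  -- All terms are dominated by one integrable function times summable geometric weights, which
  -- permits exchanging sum and integral.
  have hsum : Summable fun n => ∫ x, ‖mellinIntegrand (polylogTermKernel b z n) u x‖
      ∂orthantMeasure (Fin r) := by
    refine Summable.of_nonneg_of_le (fun n => integral_nonneg fun x => norm_nonneg _) (fun n => ?_)
      (hgeom.mul_right (∫ x, mellinBound (Fin r) δ (‖u‖ + 1) 1 x ∂orthantMeasure (Fin r)))
    rw [← integral_const_mul]
    exact integral_mono_ae (hint n).norm (hB.const_mul _) (hle n)
  have key := (hasSum_integral_of_summable_integral_norm hint hsum).mul_left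
    (∏ j, 1 / Complex.Gamma (u j))
  have htsum : ∫ x, ∑' n, mellinIntegrand (polylogTermKernel b z n) u x ∂orthantMeasure (Fin r) =
      ∫ x, mellinIntegrand (polylogKernel b z) u x ∂orthantMeasure (Fin r) := by
    refine integral_congr_ae ?_
    filter_upwards [ae_orthantMeasure_pos] with x hx
    exact ((hasSum_polylogTermKernel hz hx).mul_left _).tsum_eq
  rw [htsum] at key
  have hterm := fun n => gammaMellin_polylogTermKernel hb hu z n
  simp only [gammaMellin] at hterm ⊢
  simpa only [hterm] using key

theorem isAnalyticContinuation_polylogSeries [NeZero r] {b : Fin r → ℕ} (hb : 1 ≤ b 0)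
    {u : Fin r → ℂ} (hu : ∀ j, 0 < (u j).re) :
    IsAnalyticContinuation (polylogSeries u b) (unitPolydisc r) (cutDomain r)
      fun z => gammaMellin (polylogKernel b z) u :=
  ⟨differentiableOn_gammaMellin_polylogKernel hb hu,
    fun _ hz => (hasSum_polylogTerm hb hu hz).tsum_eq.symm⟩

theorem polylog_eq_gammaMellin [NeZero r] {b : Fin r → ℕ} (hb : 1 ≤ b 0)
    {u : Fin r → ℂ} (hu : ∀ j, 0 < (u j).re) {z : Fin r → ℂ} (hz : z ∈ cutDomain r) :
    polylog u b z = gammaMellin (polylogKernel b z) u :=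
  eqOn_analyticContinuation isOpen_cutDomain starConvex_cutDomain unitPolydisc_mem_nhds
    zero_mem_cutDomain (isAnalyticContinuation_polylogSeries hb hu) hz

end

/-! ### Exponential quotients and a family closed under differentiation. -/

theorem hasDerivAt_prod_of_logDeriv {κ : Type*} {f : κ → ℝ → ℂ} {ℓ : κ → ℂ} {x : ℝ}
    (s : Finset κ) (hf : ∀ j ∈ s, HasDerivAt (f j) (f j x * ℓ j) x) :
    HasDerivAt (fun x => ∏ j ∈ s, f j x) ((∏ j ∈ s, f j x) * ∑ j ∈ s, ℓ j) x := by
  classical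
  induction s using Finset.induction_on with
  | empty => simpa using hasDerivAt_const x (1 : ℂ)
  | insert i s hi ih =>
    have h := (hf i (Finset.mem_insert_self i s)).mul
      (ih fun j hj => hf j (Finset.mem_insert_of_mem hj))
    simp only [Finset.prod_insert hi, Finset.sum_insert hi]
    convert! h using 1
    ring

section
variable {ι κ : Type*}

/-- The denominator `exp A + exp B - 1` for linear forms `A` and `B`. -/
noncomputable def expDenom (A B : (ι → ℝ) →ₗ[ℝ] ℝ) (y : ι → ℝ) : ℝ :=
  Real.exp (A y) + Real.exp (B y) - 1

/-- The quotient `exp L / (exp A + exp B - 1)` for linear forms `L`, `A` and `B`. -/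
noncomputable def expQuot (L A B : (ι → ℝ) →ₗ[ℝ] ℝ) (y : ι → ℝ) : ℂ :=
  (Real.exp (L y) / expDenom A B y : ℝ)

theorem LinearMap.hasDerivAt_update [DecidableEq ι] (L : (ι → ℝ) →ₗ[ℝ] ℝ) (y : ι → ℝ) (i : ι) :
    HasDerivAt (fun x => L (Function.update y i x)) (L (Pi.single i 1)) (y i) := by
  have h (x : ℝ) : L (Function.update y i x) = L y + (x - y i) * L (Pi.single i 1) := by
    have : Function.update y i x = y + (x - y i) • Pi.single i 1 := by
      ext j
      by_cases hj : j = i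
      · subst hj; simp
      · simp [hj]
    rw [this, map_add, map_smul, smul_eq_mul]
  simp only [h]
  simpa using (((hasDerivAt_id (y i)).sub_const (y i)).mul_const (L (Pi.single i 1))).const_add (L y)

theorem one_le_expDenom {A B : (ι → ℝ) →ₗ[ℝ] ℝ} {y : ι → ℝ} (hA : 0 ≤ A y) (hB : 0 ≤ B y) :
    Real.exp (A y) ≤ expDenom A B y ∧ Real.exp (B y) ≤ expDenom A B y ∧ 0 < expDenom A B y := by
  have h1 := Real.one_le_exp hA
  have h2 := Real.one_le_exp hB
  unfold expDenom
  refine ⟨?_, ?_, ?_⟩ <;> linarith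

theorem measurable_expQuot [Fintype ι] (L A B : (ι → ℝ) →ₗ[ℝ] ℝ) : Measurable (expQuot L A B) := by
  unfold expQuot expDenom
  have h (L : (ι → ℝ) →ₗ[ℝ] ℝ) : Measurable fun y => L y :=
    L.continuous_of_finiteDimensional.measurable
  fun_prop

/-- The logarithmic derivative involves only constants and the two quotients with numerators exp A
and exp B. These do not depend on L and are bounded by 1 where A, B ≥ 0, so differentiation costs no
decay. -/
theorem hasDerivAt_expQuot [DecidableEq ι] {L A B : (ι → ℝ) →ₗ[ℝ] ℝ} {y : ι → ℝ} (hA : 0 ≤ A y) (hB : 0 ≤ B y)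
    (i : ι) : HasDerivAt (fun x => expQuot L A B (Function.update y i x))
      (expQuot L A B y * ((L (Pi.single i 1) : ℂ) - (A (Pi.single i 1) : ℂ) * expQuot A A B y -
        (B (Pi.single i 1) : ℂ) * expQuot B A B y)) (y i) := by
  have hL := (L.hasDerivAt_update y i).exp
  have hD : HasDerivAt (fun x => expDenom A B (Function.update y i x)) _ (y i) :=
    ((A.hasDerivAt_update y i).exp.add (B.hasDerivAt_update y i).exp).sub_const 1
  have hne : expDenom A B (Function.update y i (y i)) ≠ 0 := by
    simpa using (one_le_expDenom hA hB).2.2.ne'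
  have h := (hL.fun_div hD hne).ofReal_comp
  unfold expQuot
  convert! h using 1
  simp only [Function.update_eq_self] at hne ⊢
  rw [← Complex.ofReal_mul, ← Complex.ofReal_mul, ← Complex.ofReal_sub, ← Complex.ofReal_sub,
    ← Complex.ofReal_mul]
  congr 1
  field_simp
  ring

/-- The algebra generated by the quotients `exp A_j / (exp A_j + exp B_j - 1)` and
`exp B_j / (exp A_j + exp B_j - 1)`. -/
noncomputable def expQuotAlgebra (A B : κ → (ι → ℝ) →ₗ[ℝ] ℝ) : Subalgebra ℂ ((ι → ℝ) → ℂ) :=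
  Algebra.adjoin ℂ (range (fun j => expQuot (A j) (A j) (B j)) ∪
    range fun j => expQuot (B j) (A j) (B j))

theorem expQuot_left_mem (A B : κ → (ι → ℝ) →ₗ[ℝ] ℝ) (j : κ) :
    expQuot (A j) (A j) (B j) ∈ expQuotAlgebra A B :=
  Algebra.subset_adjoin (Or.inl ⟨j, rfl⟩)

theorem expQuot_right_mem (A B : κ → (ι → ℝ) →ₗ[ℝ] ℝ) (j : κ) :
    expQuot (B j) (A j) (B j) ∈ expQuotAlgebra A B :=
  Algebra.subset_adjoin (Or.inr ⟨j, rfl⟩)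

/-- The logarithmic derivative of `expQuot L (A j) (B j)` along the `i`-th coordinate. -/
noncomputable def expQuotLogDeriv [DecidableEq ι] (L A B : (ι → ℝ) →ₗ[ℝ] ℝ) (i : ι) : (ι → ℝ) → ℂ :=
  algebraMap ℂ _ (L (Pi.single i 1) : ℂ) - (A (Pi.single i 1) : ℂ) • expQuot A A B -
    (B (Pi.single i 1) : ℂ) • expQuot B A B

theorem expQuotLogDeriv_mem [DecidableEq ι] (L : (ι → ℝ) →ₗ[ℝ] ℝ) (A B : κ → (ι → ℝ) →ₗ[ℝ] ℝ) (j : κ) (i : ι) :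
    expQuotLogDeriv L (A j) (B j) i ∈ expQuotAlgebra A B :=
  sub_mem (sub_mem (Subalgebra.algebraMap_mem _ _)
    (Subalgebra.smul_mem _ (expQuot_left_mem A B j) _))
    (Subalgebra.smul_mem _ (expQuot_right_mem A B j) _)

theorem measurable_of_mem_expQuotAlgebra [Fintype ι] {A B : κ → (ι → ℝ) →ₗ[ℝ] ℝ} {c : (ι → ℝ) → ℂ}
    (hc : c ∈ expQuotAlgebra A B) : Measurable c := by
  induction hc using Algebra.adjoin_induction with
  | mem f hf =>
    rcases hf with ⟨j, rfl⟩ | ⟨j, rfl⟩ <;> exact measurable_expQuot _ _ _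
  | algebraMap z => exact measurable_const
  | add f g _ _ hf hg => exact hf.add hg
  | mul f g _ _ hf hg => exact hf.mul hg

theorem bounded_of_mem_expQuotAlgebra {A B : κ → (ι → ℝ) →ₗ[ℝ] ℝ}
    (hA : ∀ j y, (∀ i, 0 < y i) → 0 ≤ A j y) (hB : ∀ j y, (∀ i, 0 < y i) → 0 ≤ B j y)
    {c : (ι → ℝ) → ℂ} (hc : c ∈ expQuotAlgebra A B) :
    ∃ C, 0 ≤ C ∧ ∀ y, (∀ i, 0 < y i) → ‖c y‖ ≤ C := by
  induction hc using Algebra.adjoin_induction with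
  | mem f hf =>
    refine ⟨1, zero_le_one, fun y hy => ?_⟩
    rcases hf with ⟨j, rfl⟩ | ⟨j, rfl⟩
    all_goals
      obtain ⟨h1, h2, h3⟩ := one_le_expDenom (hA j y hy) (hB j y hy)
      simp only [expQuot]
      rw [Complex.norm_real, Real.norm_of_nonneg (div_nonneg (Real.exp_pos _).le h3.le),
        div_le_one h3]
      assumption
  | algebraMap z => exact ⟨‖z‖, norm_nonneg _, fun y _ => le_rfl⟩
  | add f g _ _ hf hg =>
    obtain ⟨C, hC, h⟩ := hf
    obtain ⟨C', hC', h'⟩ := hg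
    exact ⟨C + C', by positivity, fun y hy => (norm_add_le _ _).trans (add_le_add (h y hy) (h' y hy))⟩
  | mul f g _ _ hf hg =>
    obtain ⟨C, hC, h⟩ := hf
    obtain ⟨C', hC', h'⟩ := hg
    refine ⟨C * C', by positivity, fun y hy => ?_⟩
    rw [Pi.mul_apply, norm_mul]
    exact mul_le_mul (h y hy) (h' y hy) (norm_nonneg _) hC

theorem exists_hasDerivAt_of_mem_expQuotAlgebra [DecidableEq ι] {A B : κ → (ι → ℝ) →ₗ[ℝ] ℝ}
    (hA : ∀ j y, (∀ i, 0 < y i) → 0 ≤ A j y) (hB : ∀ j y, (∀ i, 0 < y i) → 0 ≤ B j y)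
    {c : (ι → ℝ) → ℂ} (hc : c ∈ expQuotAlgebra A B) (i : ι) :
    ∃ d ∈ expQuotAlgebra A B, ∀ y, (∀ j, 0 < y j) →
      HasDerivAt (fun x => c (Function.update y i x)) (d y) (y i) := by
  induction hc using Algebra.adjoin_induction with
  | mem f hf =>
    rcases hf with ⟨j, rfl⟩ | ⟨j, rfl⟩
    · exact ⟨_, mul_mem (expQuot_left_mem A B j) (expQuotLogDeriv_mem (A j) A B j i),
        fun y hy => hasDerivAt_expQuot (hA j y hy) (hB j y hy) i⟩
    · exact ⟨_, mul_mem (expQuot_right_mem A B j) (expQuotLogDeriv_mem (B j) A B j i),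
        fun y hy => hasDerivAt_expQuot (hA j y hy) (hB j y hy) i⟩
  | algebraMap z => exact ⟨0, zero_mem _, fun y _ => hasDerivAt_const _ _⟩
  | add f g _ _ hf hg =>
    obtain ⟨d, hd, h⟩ := hf
    obtain ⟨d', hd', h'⟩ := hg
    exact ⟨d + d', add_mem hd hd', fun y hy => (h y hy).add (h' y hy)⟩
  | mul f g hf0 hg0 hf hg =>
    obtain ⟨d, hd, h⟩ := hf
    obtain ⟨d', hd', h'⟩ := hg
    refine ⟨d * g + f * d', add_mem (mul_mem hd hg0) (mul_mem hf0 hd'), fun y hy => ?_⟩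
    convert! (h y hy).mul (h' y hy) using 1
    simp

/-- The products of `∏ j, expQuot (L j) (A j) (B j)` with members of `expQuotAlgebra A B`. -/
def expQuotFamily [Fintype κ] (L A B : κ → (ι → ℝ) →ₗ[ℝ] ℝ) : Set ((ι → ℝ) → ℂ) :=
  {f | ∃ c ∈ expQuotAlgebra A B, f = fun y => (∏ j, expQuot (L j) (A j) (B j) y) * c y}

theorem prod_expQuot_mem [Fintype κ] (L A B : κ → (ι → ℝ) →ₗ[ℝ] ℝ) :
    (fun y => ∏ j, expQuot (L j) (A j) (B j) y) ∈ expQuotFamily L A B :=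
  ⟨1, one_mem _, by simp⟩

/-- The decay sits entirely in the fixed product, since members of the algebra are bounded. By the
product rule a derivative only replaces the algebra factor c by (sum of logarithmic derivatives) * c
+ c'. -/
theorem isDerivClosed_expQuotFamily [Fintype ι] [DecidableEq ι] [Fintype κ] {L A B : κ → (ι → ℝ) →ₗ[ℝ] ℝ} {ε : ℝ}
    (hA : ∀ j y, (∀ i, 0 < y i) → 0 ≤ A j y) (hB : ∀ j y, (∀ i, 0 < y i) → 0 ≤ B j y)
    (hL : ∀ y, (∀ i, 0 < y i) →
      ‖∏ j, expQuot (L j) (A j) (B j) y‖ ≤ Real.exp (-ε * ∑ i, y i)) :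
    IsDerivClosed ε (expQuotFamily L A B) where
  decaying := by
    rintro _ ⟨c, hc, rfl⟩
    obtain ⟨C, hC, h⟩ := bounded_of_mem_expQuotAlgebra hA hB hc
    refine ⟨?_, C, hC, fun y hy => ?_⟩
    · have := measurable_of_mem_expQuotAlgebra hc
      have := fun j => measurable_expQuot (L j) (A j) (B j)
      fun_prop
    · rw [norm_mul, mul_comm]
      exact mul_le_mul (h y hy) (hL y hy) (norm_nonneg _) hC
  deriv := by
    rintro _ ⟨c, hc, rfl⟩ i
    obtain ⟨d, hd, h⟩ := exists_hasDerivAt_of_mem_expQuotAlgebra hA hB hc i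
    refine ⟨_, ⟨-((∑ j, expQuotLogDeriv (L j) (A j) (B j) i) * c + d), neg_mem (add_mem
      (mul_mem (sum_mem fun j _ => expQuotLogDeriv_mem (L j) A B j i) hc) hd), rfl⟩,
      fun y hy => ?_⟩
    have h1 := hasDerivAt_prod_of_logDeriv (x := y i)
      (f := fun j x => expQuot (L j) (A j) (B j) (Function.update y i x))
      (ℓ := fun j => expQuotLogDeriv (L j) (A j) (B j) i y) Finset.univ fun j _ => by
        simp only [Function.update_eq_self]
        exact hasDerivAt_expQuot (hA j y hy) (hB j y hy) i
    convert! h1.mul (h y hy) using 1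
    simp only [Function.update_eq_self, Pi.neg_apply, Pi.add_apply, Pi.mul_apply, Finset.sum_apply]
    ring

end

/-! ### The symmetric kernel and its exponential decay. -/

section
variable {r : ℕ}

/-- The symmetric kernel of the double integral representation of `η`. -/
noncomputable def etaKernel (σ : Equiv.Perm (Fin r)) (a b : Fin r → ℕ) (x t : Fin r → ℝ) : ℂ :=
  ∏ j, ((Real.exp ((1 - (b j : ℝ)) * tailSum x j + (1 - (a (σ j) : ℝ)) * tailSum t (σ j)) /
    (Real.exp (tailSum x j) + Real.exp (tailSum t (σ j)) - 1) : ℝ) : ℂ)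

theorem etaKernel_symm (σ : Equiv.Perm (Fin r)) (a b : Fin r → ℕ) (x t : Fin r → ℝ) :
    etaKernel σ⁻¹ b a t x = etaKernel σ a b x t := by
  unfold etaKernel
  rw [← Equiv.prod_comp σ]
  refine Finset.prod_congr rfl fun j _ => ?_
  rw [show σ⁻¹ (σ j) = j from σ.symm_apply_apply j, add_comm ((1 - (a (σ j) : ℝ)) * _),
    add_comm (Real.exp (tailSum t (σ j)))]

/-- The exponent gained from one factor of the kernel. -/
theorem sub_max_le {m n : ℕ} (h : 1 ≤ m + n) {X T : ℝ} (hX : 0 ≤ X) (hT : 0 ≤ T) :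
    (1 - (n : ℝ)) * X + (1 - (m : ℝ)) * T - max X T ≤ 0 := by
  have h1 : (1 : ℝ) ≤ m + n := by exact_mod_cast h
  rcases le_total X T with hXT | hXT
  · rw [max_eq_right hXT]
    rcases Nat.eq_zero_or_pos m with rfl | hm
    · simp only [Nat.cast_zero, zero_add] at h1 ⊢
      nlinarith
    · have : (1 : ℝ) ≤ m := by exact_mod_cast hm
      nlinarith [mul_nonneg (Nat.cast_nonneg (α := ℝ) n) hX]
  · rw [max_eq_left hXT]
    rcases Nat.eq_zero_or_pos n with rfl | hn
    · simp only [Nat.cast_zero, add_zero] at h1 ⊢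
      nlinarith
    · have : (1 : ℝ) ≤ n := by exact_mod_cast hn
      nlinarith [mul_nonneg (Nat.cast_nonneg (α := ℝ) m) hT]

theorem sub_max_le_neg_right {m n : ℕ} (hm : 1 ≤ m) (hn : 1 ≤ n) {X T : ℝ} (hX : 0 ≤ X)
    (hT : 0 ≤ T) : (1 - (n : ℝ)) * X + (1 - (m : ℝ)) * T - max X T ≤ -max X T := by
  have h1 : (1 : ℝ) ≤ m := by exact_mod_cast hm
  have h2 : (1 : ℝ) ≤ n := by exact_mod_cast hn
  nlinarith

/-- All summands are nonpositive, so it suffices to keep k = σ⁻¹(0) and 0. The k-th is at most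
-max(X_k, T_0), which settles k = 0. If k ≠ 0, the 0-th is at most both 0 and T_0 - X_0, so the
total is at most both -T_0 and -X_0. Averaging these two bounds produces the factor 1/2. -/
theorem sum_exponent_le [NeZero r] {σ : Equiv.Perm (Fin r)} {a b : Fin r → ℕ} (ha₁ : 1 ≤ a 0)
    (hb₁ : 1 ≤ b 0) (hbσ : 1 ≤ b (σ⁻¹ 0)) (hab : ∀ j, 1 ≤ a (σ j) + b j) {X T : Fin r → ℝ}
    (hX : ∀ j, 0 ≤ X j) (hT : ∀ j, 0 ≤ T j) (hT0 : ∀ j, T j ≤ T 0) :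
    ∑ j, ((1 - (b j : ℝ)) * X j + (1 - (a (σ j) : ℝ)) * T (σ j) - max (X j) (T (σ j))) ≤
      -(X 0 + T 0) / 2 := by
  set f : Fin r → ℝ := fun j =>
    (1 - (b j : ℝ)) * X j + (1 - (a (σ j) : ℝ)) * T (σ j) - max (X j) (T (σ j)) with hf
  have hf0 (j : Fin r) : f j ≤ 0 := sub_max_le (hab j) (hX j) (hT _)
  have hsub (s : Finset (Fin r)) : ∑ j, f j ≤ ∑ j ∈ s, f j := by
    have := Finset.sum_le_sum_of_subset_of_nonneg (f := fun j => -f j) (Finset.subset_univ s)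
      fun j _ _ => neg_nonneg.2 (hf0 j)
    simpa only [Finset.sum_neg_distrib, neg_le_neg_iff] using this
  set k := σ⁻¹ 0 with hk
  have hσk : σ k = 0 := by simp [hk]
  have hfk : f k ≤ -max (X k) (T 0) := by
    have := sub_max_le_neg_right (m := a (σ k)) (by rwa [hσk]) hbσ (hX k) (hT (σ k))
    simpa only [hf, hσk] using this
  have hfkT : f k ≤ -T 0 := hfk.trans (neg_le_neg (le_max_right _ _))
  by_cases h : k = 0
  · have h1 : ∑ j, f j ≤ f k :=
      (hsub {k}).trans_eq (by simp)
    have : f k ≤ -X 0 := hfk.trans (by rw [h]; exact neg_le_neg (le_max_left _ _))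
    linarith
  · have h1 : ∑ j, f j ≤ f k + f 0 :=
      (hsub {k, 0}).trans_eq (Finset.sum_pair h)
    have h2 : (1 : ℝ) ≤ b 0 := by exact_mod_cast hb₁
    have h3 : f 0 ≤ T 0 - X 0 := by
      have := le_max_left (X 0) (T (σ 0))
      have := mul_nonneg (sub_nonneg.2 h2) (hX 0)
      have := mul_nonneg (Nat.cast_nonneg (α := ℝ) (a (σ 0))) (hT (σ 0))
      simp only [hf]
      linarith [hT0 (σ 0)]
    linarith [hf0 0]

/-- For X, T ≥ 0 the smaller of e^X and e^T is at least 1, so the denominator is at least exp(max(X,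
T)), and `sum_exponent_le` bounds the resulting exponent. -/
theorem norm_etaKernel_le [NeZero r] {σ : Equiv.Perm (Fin r)} {a b : Fin r → ℕ} (ha₁ : 1 ≤ a 0)
    (hb₁ : 1 ≤ b 0) (hbσ : 1 ≤ b (σ⁻¹ 0)) (hab : ∀ j, 1 ≤ a (σ j) + b j) {x t : Fin r → ℝ}
    (hx : ∀ i, 0 < x i) (ht : ∀ i, 0 < t i) :
    ‖etaKernel σ a b x t‖ ≤ Real.exp (-(∑ i, x i + ∑ i, t i) / 2) := by
  rw [← tailSum_zero x, ← tailSum_zero t]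
  refine le_trans ?_ (Real.exp_le_exp.2 (sum_exponent_le (X := tailSum x) (T := tailSum t)
    ha₁ hb₁ hbσ hab (fun j => (tailSum_pos hx j).le) (fun j => (tailSum_pos ht j).le)
    (tailSum_le_tailSum_zero ht)))
  rw [etaKernel, norm_prod, Real.exp_sum]
  refine Finset.prod_le_prod (fun _ _ => norm_nonneg _) fun j _ => ?_
  have h1 := Real.one_le_exp (tailSum_pos hx j).le
  have h2 := Real.one_le_exp (tailSum_pos ht (σ j)).le
  have h3 : Real.exp (max (tailSum x j) (tailSum t (σ j))) ≤
      Real.exp (tailSum x j) + Real.exp (tailSum t (σ j)) - 1 := by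
    rcases max_cases (tailSum x j) (tailSum t (σ j)) with h | h <;> rw [h.1] <;> linarith
  have h4 := (Real.exp_pos _).trans_le h3
  rw [Complex.norm_real, Real.norm_of_nonneg (div_nonneg (Real.exp_pos _).le h4.le), Real.exp_sub]
  exact div_le_div_of_nonneg_left (Real.exp_pos _).le (Real.exp_pos _) h3

/-- `tailSum` as a linear form. -/
def tailSumLinear (j : Fin r) : (Fin r → ℝ) →ₗ[ℝ] ℝ := ∑ i ∈ Finset.Ici j, LinearMap.proj i

theorem tailSumLinear_apply (j : Fin r) (t : Fin r → ℝ) : tailSumLinear j t = tailSum t j := by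
  simp [tailSumLinear, tailSum]

/-- The symmetric kernel as a function of all `2r` variables. -/
noncomputable def etaSumKernel (σ : Equiv.Perm (Fin r)) (a b : Fin r → ℕ)
    (y : Fin r ⊕ Fin r → ℝ) : ℂ :=
  etaKernel σ a b (fun i => y (Sum.inl i)) fun i => y (Sum.inr i)

theorem exists_isDerivClosed_etaSumKernel_mem [NeZero r] {σ : Equiv.Perm (Fin r)}
    {a b : Fin r → ℕ} (ha₁ : 1 ≤ a 0) (hb₁ : 1 ≤ b 0) (hbσ : 1 ≤ b (σ⁻¹ 0))
    (hab : ∀ j, 1 ≤ a (σ j) + b j) :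
    ∃ D, IsDerivClosed (1 / 2) D ∧ etaSumKernel σ a b ∈ D := by
  let A : Fin r → (Fin r ⊕ Fin r → ℝ) →ₗ[ℝ] ℝ := fun j =>
    tailSumLinear j ∘ₗ LinearMap.funLeft ℝ ℝ Sum.inl
  let B : Fin r → (Fin r ⊕ Fin r → ℝ) →ₗ[ℝ] ℝ := fun j =>
    tailSumLinear (σ j) ∘ₗ LinearMap.funLeft ℝ ℝ Sum.inr
  let L : Fin r → (Fin r ⊕ Fin r → ℝ) →ₗ[ℝ] ℝ := fun j =>
    (1 - (b j : ℝ)) • A j + (1 - (a (σ j) : ℝ)) • B j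
  have hAy (j : Fin r) (y : Fin r ⊕ Fin r → ℝ) :
      A j y = tailSum (fun i => y (Sum.inl i)) j := tailSumLinear_apply _ _
  have hBy (j : Fin r) (y : Fin r ⊕ Fin r → ℝ) :
      B j y = tailSum (fun i => y (Sum.inr i)) (σ j) := tailSumLinear_apply _ _
  have hk : (fun y => ∏ j, expQuot (L j) (A j) (B j) y) = etaSumKernel σ a b := by
    ext y
    refine Finset.prod_congr rfl fun j _ => ?_
    simp only [expQuot, expDenom, L, LinearMap.add_apply, LinearMap.smul_apply, smul_eq_mul,
      hAy, hBy]
  refine ⟨expQuotFamily L A B, isDerivClosed_expQuotFamily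
    (fun j y hy => by rw [hAy]; exact (tailSum_pos (fun i => hy _) j).le)
    (fun j y hy => by rw [hBy]; exact (tailSum_pos (fun i => hy _) _).le) fun y hy => ?_,
    hk ▸ prod_expQuot_mem L A B⟩
  have := norm_etaKernel_le ha₁ hb₁ hbσ hab (x := fun i => y (Sum.inl i))
    (t := fun i => y (Sum.inr i)) (fun i => hy _) fun i => hy _
  rw [congrFun hk y]
  refine this.trans_eq ?_
  rw [Fintype.sum_sum_type]
  ring_nf

end

/-! ### Double integral representation of η and the duality. -/

section
variable {r : ℕ}

/-- The integrand of the double integral representation of `η`. -/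
noncomputable def etaDoubleIntegrand (σ : Equiv.Perm (Fin r)) (a b : Fin r → ℕ)
    (u s : Fin r → ℂ) (p : (Fin r → ℝ) × (Fin r → ℝ)) : ℂ :=
  (∏ j, (p.1 j : ℂ) ^ (u j - 1)) * (∏ j, (p.2 j : ℂ) ^ (s j - 1)) * etaKernel σ a b p.1 p.2

theorem etaDoubleIntegrand_swap (σ : Equiv.Perm (Fin r)) (a b : Fin r → ℕ) (u s : Fin r → ℂ)
    (p : (Fin r → ℝ) × (Fin r → ℝ)) :
    etaDoubleIntegrand σ⁻¹ b a s u p.swap = etaDoubleIntegrand σ a b u s p := by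
  simp only [etaDoubleIntegrand, Prod.fst_swap, Prod.snd_swap, etaKernel_symm]
  ring

theorem mellinIntegrand_etaSumKernel (σ : Equiv.Perm (Fin r)) (a b : Fin r → ℕ)
    (u s : Fin r → ℂ) (p : (Fin r → ℝ) × (Fin r → ℝ)) :
    mellinIntegrand (etaSumKernel σ a b) (Sum.elim u s)
      ((MeasurableEquiv.sumPiEquivProdPi fun _ => ℝ).symm p) = etaDoubleIntegrand σ a b u s p := by
  simp only [mellinIntegrand, etaDoubleIntegrand, Fintype.prod_sum_type]
  rfl

theorem measurePreserving_orthantMeasure_sum :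
    MeasurePreserving (MeasurableEquiv.sumPiEquivProdPi fun _ : Fin r ⊕ Fin r => ℝ).symm
      ((orthantMeasure (Fin r)).prod (orthantMeasure (Fin r))) (orthantMeasure (Fin r ⊕ Fin r)) :=
  measurePreserving_sumPiEquivProdPi_symm fun _ => volume.restrict (Ioi 0)

theorem gammaMellin_etaSumKernel (σ : Equiv.Perm (Fin r)) (a b : Fin r → ℕ)
    (u s : Fin r → ℂ) :
    gammaMellin (etaSumKernel σ a b) (Sum.elim u s) =
      (∏ j, 1 / Complex.Gamma (u j)) * (∏ j, 1 / Complex.Gamma (s j)) *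
        ∫ p, etaDoubleIntegrand σ a b u s p
          ∂(orthantMeasure (Fin r)).prod (orthantMeasure (Fin r)) := by
  rw [gammaMellin, Fintype.prod_sum_type, ← measurePreserving_orthantMeasure_sum.integral_comp']
  simp only [mellinIntegrand_etaSumKernel, Sum.elim_inl, Sum.elim_inr]

theorem integrable_etaDoubleIntegrand [NeZero r] {σ : Equiv.Perm (Fin r)}
    {a b : Fin r → ℕ} (ha₁ : 1 ≤ a 0) (hb₁ : 1 ≤ b 0) (hbσ : 1 ≤ b (σ⁻¹ 0))
    (hab : ∀ j, 1 ≤ a (σ j) + b j) {u s : Fin r → ℂ} (hu : ∀ j, 0 < (u j).re)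
    (hs : ∀ j, 0 < (s j).re) :
    Integrable (etaDoubleIntegrand σ a b u s)
      ((orthantMeasure (Fin r)).prod (orthantMeasure (Fin r))) := by
  obtain ⟨D, hD, hmem⟩ := exists_isDerivClosed_etaSumKernel_mem ha₁ hb₁ hbσ hab
  have h := (hD.decaying _ hmem).integrable_mellinIntegrand one_half_pos (w := Sum.elim u s)
    (by rintro (j | j) <;> simp [hu, hs])
  have := (measurePreserving_orthantMeasure_sum.integrable_comp_emb
    (MeasurableEquiv.measurableEmbedding _)).2 h
  refine this.congr (Eventually.of_forall fun p => ?_)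
  exact mellinIntegrand_etaSumKernel σ a b u s p

theorem etaPoint_mem_cutDomain (σ : Equiv.Perm (Fin r)) (t : Fin r → ℝ) :
    etaPoint σ t ∈ cutDomain r := by
  intro j x hx h
  have h1 : (1 - Real.exp (tailSum t (σ j)) : ℝ) = x := by
    rw [etaPoint] at h
    exact_mod_cast h
  linarith [Real.exp_pos (tailSum t (σ j))]

theorem etaPoint_ne_zero (σ : Equiv.Perm (Fin r)) {t : Fin r → ℝ} (ht : ∀ i, 0 < t i)
    (j : Fin r) : etaPoint σ t j ≠ 0 := by
  intro h
  have h1 : (1 - Real.exp (tailSum t (σ j)) : ℝ) = 0 := by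
    rw [etaPoint] at h
    exact_mod_cast h
  linarith [Real.add_one_lt_exp (tailSum_pos ht (σ j)).ne', tailSum_pos ht (σ j)]

/-- The substitution z_j = 1 - exp(T_σ(j)) makes the denominators symmetric. The powers z_j^(b_j)
cancel since T_σ(j) > 0 keeps z_j away from 0, and the product over a is reindexed by σ. -/
theorem prod_exp_mul_polylogKernel_div (σ : Equiv.Perm (Fin r)) (a b : Fin r → ℕ)
    (x : Fin r → ℝ) {t : Fin r → ℝ} (ht : ∀ i, 0 < t i) :
    (∏ j, Complex.exp ((1 - (a j : ℂ)) * (tailSum t j : ℂ))) *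
      (polylogKernel b (etaPoint σ t) x / ∏ j, etaPoint σ t j ^ b j) = etaKernel σ a b x t := by
  rw [polylogKernel, etaKernel, ← Finset.prod_div_distrib,
    ← Equiv.prod_comp σ fun j => Complex.exp ((1 - (a j : ℂ)) * (tailSum t j : ℂ)),
    ← Finset.prod_mul_distrib]
  refine Finset.prod_congr rfl fun j _ => ?_
  have hz := pow_ne_zero (b j) (etaPoint_ne_zero σ ht j)
  have hden : (Real.exp (tailSum x j) : ℂ) - etaPoint σ t j =
      ((Real.exp (tailSum x j) + Real.exp (tailSum t (σ j)) - 1 : ℝ) : ℂ) := by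
    rw [etaPoint]; push_cast; ring
  have hexp : Complex.exp ((1 - (a (σ j) : ℂ)) * (tailSum t (σ j) : ℂ)) =
      (Real.exp ((1 - (a (σ j) : ℝ)) * tailSum t (σ j)) : ℂ) := by push_cast; rfl
  rw [hden, hexp, Complex.ofReal_div, Real.exp_add, Complex.ofReal_mul, mul_div_right_comm,
    mul_div_assoc]
  field_simp

theorem etaIntegrand_eq [NeZero r] (σ : Equiv.Perm (Fin r)) (a : Fin r → ℕ) {b : Fin r → ℕ}
    (hb₁ : 1 ≤ b 0) {u : Fin r → ℂ} (hu : ∀ j, 0 < (u j).re) (s : Fin r → ℂ) {t : Fin r → ℝ}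
    (ht : ∀ i, 0 < t i) :
    etaIntegrand u s σ a b t = (∏ j, 1 / Complex.Gamma (u j)) *
      ∫ x, etaDoubleIntegrand σ a b u s (x, t) ∂orthantMeasure (Fin r) := by
  rw [etaIntegrand, polylog_eq_gammaMellin hb₁ hu (etaPoint_mem_cutDomain σ t), gammaMellin,
    Finset.prod_mul_distrib, mul_div_assoc, ← integral_div, mul_left_comm, ← integral_const_mul]
  congr 2
  ext x
  rw [etaDoubleIntegrand, mellinIntegrand, ← prod_exp_mul_polylogKernel_div σ a b x ht]
  ring

theorem etaIntegral_eq_gammaMellin [NeZero r] {σ : Equiv.Perm (Fin r)} {a b : Fin r → ℕ}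
    (hb₁ : 1 ≤ b 0) {p : (Fin r → ℂ) × (Fin r → ℂ)} (hp : p ∈ positiveRegion r)
    (hint : Integrable (etaDoubleIntegrand σ a b p.1 p.2)
      ((orthantMeasure (Fin r)).prod (orthantMeasure (Fin r)))) :
    IntegrableOn (etaIntegrand p.1 p.2 σ a b) (positiveOrthant r) ∧
      etaIntegral σ a b p = gammaMellin (etaSumKernel σ a b) (Sum.elim p.1 p.2) := by
  have hae : etaIntegrand p.1 p.2 σ a b =ᵐ[orthantMeasure (Fin r)] fun t =>
      (∏ j, 1 / Complex.Gamma (p.1 j)) *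
        ∫ x, etaDoubleIntegrand σ a b p.1 p.2 (x, t) ∂orthantMeasure (Fin r) := by
    filter_upwards [ae_orthantMeasure_pos] with t ht using etaIntegrand_eq σ a hb₁ hp.1 p.2 ht
  have hμ : volume.restrict (positiveOrthant r) = orthantMeasure (Fin r) :=
    orthantMeasure_eq_restrict.symm
  constructor
  · rw [IntegrableOn, hμ, integrable_congr hae]
    exact hint.integral_prod_right.const_mul _
  · rw [etaIntegral, hμ, integral_congr_ae hae, integral_const_mul, ← integral_prod_symm _ hint,
      gammaMellin_etaSumKernel]
    ring

theorem gammaMellin_etaSumKernel_swap (σ : Equiv.Perm (Fin r)) (a b : Fin r → ℕ)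
    (u s : Fin r → ℂ) :
    gammaMellin (etaSumKernel σ⁻¹ b a) (Sum.elim s u) =
      gammaMellin (etaSumKernel σ a b) (Sum.elim u s) := by
  rw [gammaMellin_etaSumKernel, gammaMellin_etaSumKernel, ← integral_prod_swap]
  simp only [etaDoubleIntegrand_swap]
  ring

theorem positiveRegion_mem_nhds :
    positiveRegion r ∈ 𝓝 ((fun _ => 1, fun _ => 1) : (Fin r → ℂ) × (Fin r → ℂ)) := by
  have h1 : ∀ᶠ p : (Fin r → ℂ) × (Fin r → ℂ) in 𝓝 (fun _ => 1, fun _ => 1), ∀ j, 0 < (p.1 j).re :=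
    eventually_all.2 fun j => continuousAt_const.eventually_lt
      (Continuous.continuousAt (by fun_prop)) (by simp)
  have h2 : ∀ᶠ p : (Fin r → ℂ) × (Fin r → ℂ) in 𝓝 (fun _ => 1, fun _ => 1), ∀ j, 0 < (p.2 j).re :=
    eventually_all.2 fun j => continuousAt_const.eventually_lt
      (Continuous.continuousAt (by fun_prop)) (by simp)
  exact h1.and h2

theorem eta_eq_of_isAnalyticContinuation {σ : Equiv.Perm (Fin r)} {a b : Fin r → ℕ}
    {F : (Fin r → ℂ) × (Fin r → ℂ) → ℂ}
    (hF : IsAnalyticContinuation (etaIntegral σ a b) (positiveRegion r) univ F)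
    (u s : Fin r → ℂ) : eta u s σ a b = F (u, s) :=
  eqOn_analyticContinuation isOpen_univ (starConvex_univ _) positiveRegion_mem_nhds (mem_univ _) hF
    (mem_univ _)

end

theorem theorem3p5 (r : ℕ) [NeZero r] (σ : Equiv.Perm (Fin r)) (a b : Fin r → ℕ)
    (ha₁ : 1 ≤ a 0) (haσ : 1 ≤ a (σ⁻¹ 0)) (hb₁ : 1 ≤ b 0) (hbσ : 1 ≤ b (σ⁻¹ 0))
    (hab : ∀ j, 1 ≤ a (σ j) + b j) :
    EtaWellDefined σ a b ∧ EtaWellDefined σ⁻¹ b a ∧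
      ∀ u s : Fin r → ℂ, eta u s σ a b = eta s u σ⁻¹ b a := by
  have hint (p : (Fin r → ℂ) × (Fin r → ℂ)) (hp : p ∈ positiveRegion r) :=
    integrable_etaDoubleIntegrand ha₁ hb₁ hbσ hab hp.1 hp.2
  have hint' (p : (Fin r → ℂ) × (Fin r → ℂ)) (hp : p ∈ positiveRegion r) :
      Integrable (etaDoubleIntegrand σ⁻¹ b a p.1 p.2)
        ((orthantMeasure (Fin r)).prod (orthantMeasure (Fin r))) := by
    refine (hint p.swap ⟨hp.2, hp.1⟩).swap.congr (Eventually.of_forall fun q => ?_)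
    exact (etaDoubleIntegrand_swap σ a b p.2 p.1 q.swap).symm
  obtain ⟨D, hD, hmem⟩ := exists_isDerivClosed_etaSumKernel_mem ha₁ hb₁ hbσ hab
  -- This one entire function serves both sides: the dual η is continued by G with its two blocks of
  -- variables exchanged.
  obtain ⟨G, hG, hGeq⟩ := hD.exists_entire_gammaMellin one_half_pos hmem
  have hcomp : Differentiable ℂ fun p : (Fin r → ℂ) × (Fin r → ℂ) => Sum.elim p.1 p.2 :=
    differentiable_pi.2 (by rintro (j | j) <;> simp only [Sum.elim_inl, Sum.elim_inr] <;> fun_prop)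
  have hF : IsAnalyticContinuation (etaIntegral σ a b) (positiveRegion r) univ
      fun p => G (Sum.elim p.1 p.2) := by
    refine ⟨(hG.comp hcomp).differentiableOn, fun p hp => ?_⟩
    have := (etaIntegral_eq_gammaMellin hb₁ hp (hint p hp)).2
    rw [this]
    exact hGeq _ (by rintro (j | j) <;> simp [hp.1 _, hp.2 _])
  have hF' : IsAnalyticContinuation (etaIntegral σ⁻¹ b a) (positiveRegion r) univ
      fun p => G (Sum.elim p.2 p.1) := by
    refine ⟨(hG.comp (hcomp.comp (differentiable_snd.prodMk differentiable_fst))).differentiableOn,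
      fun p hp => ?_⟩
    have := (etaIntegral_eq_gammaMellin ha₁ hp (hint' p hp)).2
    rw [this, gammaMellin_etaSumKernel_swap]
    exact hGeq _ (by rintro (j | j) <;> simp [hp.1 _, hp.2 _])
  refine ⟨⟨fun u hu z hz => (hasSum_polylogTerm hb₁ hu hz).summable,
      fun u hu => ⟨_, isAnalyticContinuation_polylogSeries hb₁ hu⟩,
      fun p hp => (etaIntegral_eq_gammaMellin hb₁ hp (hint p hp)).1, _, hF⟩,
    ⟨fun u hu z hz => (hasSum_polylogTerm ha₁ hu hz).summable,
      fun u hu => ⟨_, isAnalyticContinuation_polylogSeries ha₁ hu⟩,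
      fun p hp => (etaIntegral_eq_gammaMellin ha₁ hp (hint' p hp)).1, _, hF'⟩, fun u s => ?_⟩
  rw [eta_eq_of_isAnalyticContinuation hF, eta_eq_of_isAnalyticContinuation hF']
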